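/- Let $H=L^2(\mathbb R_+)$, let $F(H)$ be the antisymmetric Fock space over $H$ with vacuum $|0\rangle$, spanned by the vectors $|\mathbf f\rangle=f_1\wedge\dots\wedge f_n$ with $\langle\mathbf f|\mathbf g\rangle=\det(\langle f_j,g_k\rangle)$, and let $\mathfrak S_1(F(H))$ be the space of nuclear operators on $F(H)$. Let $(S_tf)(x)=f(x-t)$ for $x>t$ and $(S_tf)(x)=0$ for $x\le t$; let $\hat S_t(f_1\wedge\dots\wedge f_n)=S_tf_1\wedge\dots\wedge S_tf_n$, $\hat S_t|0\rangle=|0\rangle$; and put $\Phi_t(x)=\hat S_tx\hat S_t^*$ for $x\in B(F(H))$, $\Psi_t(\rho)=\hat S_t^*\rho\hat S_t$ for $\rho\in\mathfrak S_1(F(H))$, $t\ge 0$. For $n\ge1$ write $\mathbf f_{\backslash j}=f_1\wedge\dots\wedge f_{j-1}\wedge f_{j+1}\wedge\dots\wedge f_n$. For every Borel set $B\subseteq\mathbb R_+$ (in particular for $B=[t,s)$, $0\le t\le s\le+\infty$) there is a unique linear map $\mathcal M_*(B):\mathfrak S_1(F(H))\to\mathfrak S_1(F(H))$, bounded in the nuclear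 norm, such that $$\mathcal M_*(B)(|\mathbf f\rangle\langle\mathbf g|)=\sum_{j,k}(-1)^{j+k}\int_B f_j(r)\overline{g_k(r)}\,\Psi_r\bigl(|\mathbf f_{\backslash j}\rangle\langle\mathbf g_{\backslash k}|\bigr)\,dr$$ for all $f_1,\dots,f_m,g_1,\dots,g_n\in H$, $m,n\ge1$ (the integrals converge absolutely), and $$\mathcal M_*(B)(|0\rangle\langle\mathbf g|)=\mathcal M_*(B)(|\mathbf f\rangle\langle0|)=\mathcal M_*(B)(|0\rangle\langle0|)=0.$$ The map $\mathcal M_*(B)$ is positive, and $\mathrm{Tr}(\mathcal M_*(B)(\rho))\le\mathrm{Tr}(\rho)$ for all positive $\rho\in\mathfrak S_1(F(H))$. It has a unique adjoint $\mathcal M(B):B(F(H))\to B(F(H))$, defined by $\mathrm{Tr}(\mathcal M_*(B)(\rho)x)=\mathrm{Tr}(\rho\,\mathcal M(B)(x))$, and $\mathcal M$ is a measure covariant with respect to $\Phi$, that is, for all Borel $B\subseteq\mathbb R_+$: 1. $\mathcal M(B)$ is linear and completely positive; 2. $\mathcal M(B)(I)\le I$; 3. for all $\rho\in\mathfrak S_1(F(H))$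 and $x\in B(F(H))$ the function $B\mapsto\mathrm{Tr}(\rho\,\mathcal M(B)(x))$ is a $\sigma$-additive complex measure on the Borel subsets of $\mathbb R_+$; 4. $\Phi_r\circ\mathcal M(B)=\mathcal M(B+r)$ for all $r\ge0$; in particular $\Phi_r\circ\mathcal M([t,s))=\mathcal M([t+r,s+r))$. -/

import Mathlib

open MeasureTheory NNReal ContinuousLinearMap
open scoped ComplexConjugate InnerProductSpace ENNReal CStarAlgebra

noncomputable section

namespace ShiftCAR

/-! ### Nuclear operators on a Hilbert space -/

section Nuclear

variable {E : Type*} [NormedAddCommGroup E] [InnerProductSpace ℂ E]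

/-- The rank-one operator `|u⟩⟨v|`, i.e. `x ↦ ⟪v, x⟫ u` (the inner product is conjugate-linear in
its first argument). -/
abbrev ketBra (u v : E) : E →L[ℂ] E := InnerProductSpace.rankOne ℂ u v

/-- `T = ∑ᵢ |uᵢ⟩⟨vᵢ|` with `∑ᵢ ‖uᵢ‖ ‖vᵢ‖ < ∞`. -/
def IsNuclearRep (T : E →L[ℂ] E) (u v : ℕ → E) : Prop :=
  Summable (fun i => ‖u i‖ * ‖v i‖) ∧ HasSum (fun i => ketBra (u i) (v i)) T

/-- An operator is nuclear (trace class) if it is an absolutely convergent sum of rank-one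
operators. -/
def IsNuclear (T : E →L[ℂ] E) : Prop := ∃ u v : ℕ → E, IsNuclearRep T u v

/-- The nuclear (trace) norm: the infimum of `∑ᵢ ‖uᵢ‖ ‖vᵢ‖` over all nuclear representations. -/
def nuclearNorm (T : E →L[ℂ] E) : ℝ :=
  sInf {c | ∃ u v : ℕ → E, IsNuclearRep T u v ∧ c = ∑' i, ‖u i‖ * ‖v i‖}

theorem IsNuclear.ketBra (u v : E) : IsNuclear (ketBra u v) := by
  refine ⟨fun i => if i = 0 then u else 0, fun _ => v, ?_, ?_⟩
  · refine summable_of_ne_finset_zero (s := {0}) fun i hi => ?_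
    simp [Finset.mem_singleton.not.1 hi]
  · convert hasSum_single (f := fun i : ℕ => ShiftCAR.ketBra (if i = 0 then u else 0) v) 0 ?_
    · rfl
    · intro i hi
      simp [hi]

theorem IsNuclear.zero : IsNuclear (0 : E →L[ℂ] E) := by
  simpa using IsNuclear.ketBra (0 : E) 0

theorem IsNuclear.add {S T : E →L[ℂ] E} (hS : IsNuclear S) (hT : IsNuclear T) :
    IsNuclear (S + T) := by
  obtain ⟨u, v, h1, h2⟩ := hS
  obtain ⟨u', v', h1', h2'⟩ := hT
  obtain ⟨e⟩ : Nonempty (ℕ ≃ ℕ ⊕ ℕ) := ⟨Equiv.natSumNatEquivNat.symm⟩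
  refine ⟨Sum.elim u u' ∘ e, Sum.elim v v' ∘ e, ?_, ?_⟩
  · exact e.summable_iff.2
      (Summable.sum (fun i : ℕ ⊕ ℕ => ‖Sum.elim u u' i‖ * ‖Sum.elim v v' i‖) h1 h1')
  · have key : HasSum (Sum.elim (fun i => ShiftCAR.ketBra (u i) (v i))
        (fun i => ShiftCAR.ketBra (u' i) (v' i))) (S + T) := HasSum.sum h2 h2'
    convert e.hasSum_iff.2 key using 2 with i
    simp only [Function.comp_apply]
    cases e i <;> rfl

theorem IsNuclear.smul (c : ℂ) {T : E →L[ℂ] E} (hT : IsNuclear T) : IsNuclear (c • T) := by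
  obtain ⟨u, v, h1, h2⟩ := hT
  refine ⟨fun i => c • u i, v, ?_, ?_⟩
  · simpa [norm_smul, mul_assoc] using h1.mul_left ‖c‖
  · convert h2.const_smul c using 2 with i
    exact congrArg (fun L => L (v i)) ((InnerProductSpace.rankOne ℂ).map_smul c (u i))

variable (E) in
/-- The space `𝔖₁(E)` of nuclear operators, as a linear subspace of `B(E)`. -/
def nuclear : Submodule ℂ (E →L[ℂ] E) where
  carrier := {T | IsNuclear T}
  zero_mem' := IsNuclear.zero
  add_mem' := IsNuclear.add
  smul_mem' := IsNuclear.smul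

/-- The rank-one operator `|u⟩⟨v|` as an element of `𝔖₁(E)`. -/
def nuclearKetBra (u v : E) : nuclear E := ⟨ketBra u v, IsNuclear.ketBra u v⟩

variable [CompleteSpace E]

/-- The trace `∑ᵢ ⟪eᵢ, T eᵢ⟫` along an orthonormal basis of `E`; for nuclear `T` the sum converges
absolutely and does not depend on the basis. -/
def trace (T : E →L[ℂ] E) : ℂ :=
  ∑' e : (exists_hilbertBasis ℂ E).choose, ⟪(e : E), T (e : E)⟫_ℂ

/-! ### Covariant completely positive measures on the half-line -/

/-- `M` is a measure on the Borel subsets of `ℝ₊` whose values are completely positive and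
subunital maps of `B(E)`, which is σ-additive in the weak* sense, and which is covariant with
respect to the family `Φ`. -/
structure IsCovariantMeasure (Φ : ℝ≥0 → (E →L[ℂ] E) → (E →L[ℂ] E))
    (M : Set ℝ≥0 → ((E →L[ℂ] E) →CP (E →L[ℂ] E))) : Prop where
  subunital : ∀ B, MeasurableSet B → M B 1 ≤ 1
  sigma_additive : ∀ (ρ : nuclear E) (x : E →L[ℂ] E), ∃ ν : ComplexMeasure ℝ≥0,
    ∀ B, MeasurableSet B → ν B = trace ((ρ : E →L[ℂ] E) ∘L M B x)
  covariant : ∀ (r : ℝ≥0) (B : Set ℝ≥0), MeasurableSet B → ∀ x : E →L[ℂ] E,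
    Φ r (M B x) = M ((fun t => t + r) '' B) x

end Nuclear

/-! ### The one-particle space and the shift -/

/-- Lebesgue measure on `ℝ₊ = [0, ∞)`. -/
def lebesgue : Measure ℝ≥0 := Measure.comap ((↑) : ℝ≥0 → ℝ) volume

theorem measurableEmbedding_coe : MeasurableEmbedding ((↑) : ℝ≥0 → ℝ) :=
  MeasurableEmbedding.subtype_coe (s := {r : ℝ | 0 ≤ r}) measurableSet_Ici

theorem lebesgue_apply (B : Set ℝ≥0) : lebesgue B = volume (((↑) : ℝ≥0 → ℝ) '' B) :=
  measurableEmbedding_coe.comap_apply _ _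

instance : SigmaFinite lebesgue := by
  have : SigmaFinite (volume.restrict (Set.range ((↑) : ℝ≥0 → ℝ))) := inferInstance
  rw [← measurableEmbedding_coe.map_comap] at this
  exact SigmaFinite.of_map _ measurableEmbedding_coe.measurable.aemeasurable this

/-- The one-particle space `H = L²(ℝ₊)`. -/
abbrev OneParticle : Type := Lp ℂ 2 lebesgue

theorem measurable_sub (t : ℝ≥0) : Measurable (fun x : ℝ≥0 => x - t) :=
  measurable_id.sub_const t

theorem measurePreserving_sub (t : ℝ≥0) :
    MeasurePreserving (fun x : ℝ≥0 => x - t) (lebesgue.restrict (Set.Ici t)) lebesgue := by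
  refine ⟨measurable_sub t, ?_⟩
  ext B hB
  rw [Measure.map_apply (measurable_sub t) hB,
    Measure.restrict_apply ((measurable_sub t) hB), lebesgue_apply, lebesgue_apply,
    ← measure_preimage_add_right volume (t : ℝ)]
  congr 1
  ext y
  constructor
  · rintro ⟨x, ⟨hx, hxt⟩, hxy⟩
    refine ⟨x - t, hx, ?_⟩
    rw [NNReal.coe_sub hxt, hxy]
    ring
  · rintro ⟨x, hx, rfl⟩
    refine ⟨x + t, ⟨?_, ?_⟩, ?_⟩
    · simpa using hx
    · simp
    · simp

section Pullback

variable {α : Type*} [MeasurableSpace α] {μ : Measure α}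

theorem memLp_pullback {A : Set α} (hA : MeasurableSet A) {s : α → α}
    (hs : MeasurePreserving s (μ.restrict A) μ) (F : Lp ℂ 2 μ) :
    MemLp (A.indicator (F ∘ s)) 2 μ :=
  (memLp_indicator_iff_restrict hA).2 ((Lp.memLp F).comp_measurePreserving hs)

theorem comp_ae {A : Set α} (hA : MeasurableSet A) {s : α → α}
    (hs : MeasurePreserving s (μ.restrict A) μ) {F G : α → ℂ} (h : F =ᵐ[μ] G) :
    A.indicator (F ∘ s) =ᵐ[μ] A.indicator (G ∘ s) := by
  have h' := (ae_restrict_iff' hA).1 (hs.quasiMeasurePreserving.ae_eq_comp h)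
  filter_upwards [h'] with x hx
  by_cases hxA : x ∈ A
  · simpa [hxA] using hx hxA
  · simp [hxA]

/-- The isometry `F ↦ 1_A · (F ∘ s)` of `L²(μ)`, for a map `s` that carries `μ` restricted to `A`
to `μ`. -/
def pullback {A : Set α} (hA : MeasurableSet A) {s : α → α}
    (hs : MeasurePreserving s (μ.restrict A) μ) : Lp ℂ 2 μ →ₗᵢ[ℂ] Lp ℂ 2 μ where
  toFun F := (memLp_pullback hA hs F).toLp _
  map_add' F G := by
    rw [← MemLp.toLp_add]
    refine MemLp.toLp_congr _ _ ?_
    rw [← Set.indicator_add']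
    exact comp_ae hA hs (Lp.coeFn_add F G)
  map_smul' c F := by
    rw [RingHom.id_apply, ← MemLp.toLp_const_smul]
    refine MemLp.toLp_congr _ _ ?_
    refine (comp_ae hA hs (Lp.coeFn_smul c F)).trans (Filter.Eventually.of_forall fun x => ?_)
    by_cases hx : x ∈ A <;> simp [hx]
  norm_map' F := by
    change ‖(memLp_pullback hA hs F).toLp _‖ = _
    rw [Lp.norm_toLp, eLpNorm_indicator_eq_eLpNorm_restrict hA, Lp.norm_def,
      eLpNorm_comp_measurePreserving (Lp.aestronglyMeasurable F) hs]

end Pullback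

/-- The shift `(S_t f)(x) = f(x - t)` for `x ≥ t` and `0` for `x < t`, on `L²(ℝ₊)`. -/
def shift (t : ℝ≥0) : OneParticle →ₗᵢ[ℂ] OneParticle :=
  pullback (measurableSet_Ici (a := t)) (measurePreserving_sub t)

/-! ### The antisymmetric Fock space over `L²(ℝ₊)` -/

/-- Lebesgue measure on `ℝ₊ⁿ`. -/
abbrev lebesguePi (n : ℕ) : Measure (Fin n → ℝ≥0) := Measure.pi fun _ => lebesgue

/-- The Slater determinant `(n!)^{-1/2} det (f_j(x_i))`. -/
def slater {n : ℕ} (f : Fin n → OneParticle) (x : Fin n → ℝ≥0) : ℂ :=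
  ((Real.sqrt (n.factorial : ℝ) : ℂ))⁻¹ * (Matrix.of fun i j => f j (x i)).det

theorem memLp_slater {n : ℕ} (f : Fin n → OneParticle) : MemLp (slater f) 2 (lebesguePi n) := by
  have hm : ∀ i j, AEStronglyMeasurable (fun x : Fin n → ℝ≥0 => f j (x i)) (lebesguePi n) :=
    fun i j => (Lp.aestronglyMeasurable (f j)).comp_quasiMeasurePreserving
      (Measure.quasiMeasurePreserving_eval _ i)
  refine MemLp.const_mul ?_ _
  simp only [Matrix.det_apply]
  refine memLp_finsetSum _ fun σ _ => ?_
  have hp : MemLp (fun x : Fin n → ℝ≥0 => ∏ i, f i (x (σ i))) 2 (lebesguePi n) := by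
    have hint : Integrable (fun x : Fin n → ℝ≥0 => ∏ i, ‖f (σ.symm i) (x i)‖ ^ 2)
        (lebesguePi n) :=
      Integrable.fintype_prod (f := fun i y => ‖f (σ.symm i) y‖ ^ 2) fun i =>
        (Lp.memLp (f (σ.symm i))).integrable_norm_pow (by norm_num)
    refine (memLp_two_iff_integrable_sq_norm
      (Finset.aestronglyMeasurable_fun_prod _ fun i _ => hm (σ i) i)).2 ?_
    refine hint.congr (Filter.Eventually.of_forall fun x => ?_)
    simp only [norm_prod, ← Finset.prod_pow]
    exact Fintype.prod_equiv σ.symm _ _ fun i => by simp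
  refine (hp.const_mul ((Equiv.Perm.sign σ : ℤ) : ℂ)).congr_norm ?_ ?_
  · exact (hp.const_mul ((Equiv.Perm.sign σ : ℤ) : ℂ)).1.congr
      (Filter.Eventually.of_forall fun x => by simp [Units.smul_def])
  · exact Filter.Eventually.of_forall fun x => by simp [Units.smul_def]

/-- The vector `f₁ ∧ … ∧ fₙ` as an element of `L²(ℝ₊ⁿ)`. -/
def wedgeLp {n : ℕ} (f : Fin n → OneParticle) : Lp ℂ 2 (lebesguePi n) :=
  (memLp_slater f).toLp _

/-- The `n`-particle space: the closed linear span in `L²(ℝ₊ⁿ)` of the vectors `f₁ ∧ … ∧ fₙ`.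
For `n = 0` it is the one-dimensional space spanned by the vacuum. -/
def nParticle (n : ℕ) : Submodule ℂ (Lp ℂ 2 (lebesguePi n)) :=
  (Submodule.span ℂ (Set.range (wedgeLp (n := n)))).topologicalClosure

instance (n : ℕ) : CompleteSpace (nParticle n) :=
  (Submodule.isClosed_topologicalClosure _).completeSpace_coe

/-- The antisymmetric Fock space `F(L²(ℝ₊))`: the Hilbert sum of all `n`-particle spaces. -/
def Fock : Type := lp (fun n : ℕ => nParticle n) 2

instance : NormedAddCommGroup Fock :=
  inferInstanceAs (NormedAddCommGroup (lp (fun n : ℕ => nParticle n) 2))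

instance : InnerProductSpace ℂ Fock :=
  inferInstanceAs (InnerProductSpace ℂ (lp (fun n : ℕ => nParticle n) 2))

instance : CompleteSpace Fock :=
  inferInstanceAs (CompleteSpace (lp (fun n : ℕ => nParticle n) 2))

/-- The vector `f₁ ∧ … ∧ fₙ` of the `n`-particle space. -/
def wedgeN {n : ℕ} (f : Fin n → OneParticle) : nParticle n :=
  ⟨wedgeLp f, Submodule.le_topologicalClosure _ (Submodule.subset_span ⟨f, rfl⟩)⟩

/-- The vector `f₁ ∧ … ∧ fₙ` of the Fock space. -/
def wedge {n : ℕ} (f : Fin n → OneParticle) : Fock :=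
  (lp.single 2 n (wedgeN f) : lp (fun n : ℕ => nParticle n) 2)

/-- The vacuum vector. -/
def vacuum : Fock := wedge (Fin.elim0 : Fin 0 → OneParticle)

/-! ### Second quantization of the shift -/

theorem measurePreserving_subPi (t : ℝ≥0) (n : ℕ) :
    MeasurePreserving (fun (x : Fin n → ℝ≥0) i => x i - t)
      ((lebesguePi n).restrict (Set.univ.pi fun _ => Set.Ici t)) (lebesguePi n) := by
  rw [Measure.restrict_pi_pi]
  exact measurePreserving_pi _ _ fun _ => measurePreserving_sub t

theorem measurableSet_pi_Ici (t : ℝ≥0) (n : ℕ) :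
    MeasurableSet (Set.univ.pi fun _ : Fin n => Set.Ici t) :=
  MeasurableSet.univ_pi fun _ => measurableSet_Ici

/-- The shift by `t` in every variable, on `L²(ℝ₊ⁿ)`. -/
def shiftLp (t : ℝ≥0) (n : ℕ) : Lp ℂ 2 (lebesguePi n) →ₗᵢ[ℂ] Lp ℂ 2 (lebesguePi n) :=
  pullback (measurableSet_pi_Ici t n) (measurePreserving_subPi t n)

theorem shiftLp_wedgeLp (t : ℝ≥0) {n : ℕ} (f : Fin n → OneParticle) :
    shiftLp t n (wedgeLp f) = wedgeLp (fun j => shift t (f j)) := by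
  have h1 : ∀ᵐ x ∂lebesguePi n, ∀ i j,
      shift t (f j) (x i) = (Set.Ici t).indicator (f j ∘ fun y => y - t) (x i) := by
    rw [ae_all_iff]; intro i
    rw [ae_all_iff]; intro j
    exact (Measure.quasiMeasurePreserving_eval (fun _ : Fin n => lebesgue) i).ae
      (MemLp.coeFn_toLp (memLp_pullback measurableSet_Ici (measurePreserving_sub t) (f j)))
  have h2 := comp_ae (measurableSet_pi_Ici t n) (measurePreserving_subPi t n)
    (MemLp.coeFn_toLp (memLp_slater f))
  refine MemLp.toLp_congr 
    (memLp_pullback (measurableSet_pi_Ici t n) (measurePreserving_subPi t n) (wedgeLp f)) _ (h2.trans ?_)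
  filter_upwards [h1] with x hx
  by_cases hxA : x ∈ Set.univ.pi fun _ : Fin n => Set.Ici t
  · rw [Set.indicator_of_mem hxA]
    simp only [slater, Function.comp_apply, hx]
    congr 3
    ext i j
    simp [Set.indicator_of_mem (show x i ∈ Set.Ici t from hxA i trivial)]
  · rw [Set.indicator_of_notMem hxA]
    simp only [Set.mem_pi, Set.mem_univ, true_imp_iff, not_forall] at hxA
    obtain ⟨i, hi⟩ := hxA
    rw [slater, Matrix.det_eq_zero_of_row_eq_zero i, mul_zero]
    intro j
    simp [hx, Set.indicator_of_notMem hi]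

theorem shiftLp_mem (t : ℝ≥0) (n : ℕ) (F : Lp ℂ 2 (lebesguePi n)) (hF : F ∈ nParticle n) :
    shiftLp t n F ∈ nParticle n := by
  have hle : nParticle n ≤ (nParticle n).comap (shiftLp t n).toLinearMap := by
    refine Submodule.topologicalClosure_minimal _ (Submodule.span_le.2 ?_) ?_
    · rintro _ ⟨f, rfl⟩
      change shiftLp t n (wedgeLp f) ∈ nParticle n
      rw [shiftLp_wedgeLp]
      exact (wedgeN _).2
    · exact (Submodule.isClosed_topologicalClosure _).preimage (shiftLp t n).continuous
  exact hle hF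

/-- The shift on the `n`-particle space. -/
def shiftN (t : ℝ≥0) (n : ℕ) : nParticle n →ₗᵢ[ℂ] nParticle n where
  toLinearMap := (shiftLp t n).toLinearMap.restrict (shiftLp_mem t n)
  norm_map' F := (shiftLp t n).norm_map F

/-- The Hilbert sum of a family of isometries. -/
def lpMap {E : ℕ → Type*} [∀ n, NormedAddCommGroup (E n)] [∀ n, InnerProductSpace ℂ (E n)]
    (T : ∀ n, E n →ₗᵢ[ℂ] E n) : lp E 2 →ₗᵢ[ℂ] lp E 2 where
  toFun F := ⟨fun n => T n (F n), (memℓp_gen_iff (by norm_num)).2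
    (by simpa using (lp.memℓp F).summable (by norm_num))⟩
  map_add' F G := by ext n; exact (T n).map_add _ _
  map_smul' c F := by ext n; exact (T n).map_smul _ _
  norm_map' F := by
    change ‖(⟨fun n => T n (F n), _⟩ : lp E 2)‖ = ‖F‖
    rw [lp.norm_eq_tsum_rpow (by norm_num), lp.norm_eq_tsum_rpow (by norm_num)]
    simp

/-- The shift `Ŝ_t` in the Fock space. -/
def fockShift (t : ℝ≥0) : Fock →L[ℂ] Fock :=
  LinearIsometry.toContinuousLinearMap (E := Fock) (E₂ := Fock) (lpMap (shiftN t))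

/-- `Ŝ_t (f₁ ∧ … ∧ fₙ) = S_t f₁ ∧ … ∧ S_t fₙ`; in particular the vacuum is invariant. -/
theorem fockShift_wedge (t : ℝ≥0) {n : ℕ} (f : Fin n → OneParticle) :
    fockShift t (wedge f) = wedge (fun j => shift t (f j)) := by
  have h : shiftN t n (wedgeN f) = wedgeN (fun j => shift t (f j)) :=
    Subtype.ext (shiftLp_wedgeLp t f)
  refine lp.ext (funext fun m => ?_)
  change shiftN t m ((lp.single 2 n (wedgeN f) : lp (fun n : ℕ => nParticle n) 2) m) =
    (lp.single 2 n (wedgeN fun j => shift t (f j)) : lp (fun n : ℕ => nParticle n) 2) m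
  by_cases hm : m = n
  · subst hm
    simp [h]
  · simp [hm]

/-- The semigroup `Φ_t(x) = Ŝ_t x Ŝ_t^*` on `B(F(H))`. -/
def shiftSemigroup (t : ℝ≥0) (x : Fock →L[ℂ] Fock) : Fock →L[ℂ] Fock :=
  fockShift t ∘L x ∘L adjoint (fockShift t)

/-- The preadjoint semigroup `Ψ_t(ρ) = Ŝ_t^* ρ Ŝ_t`. -/
def preShiftSemigroup (t : ℝ≥0) (ρ : Fock →L[ℂ] Fock) : Fock →L[ℂ] Fock :=
  adjoint (fockShift t) ∘L ρ ∘L fockShift t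

/-! ### The preadjoint map -/

/-- The integrand `f_j(r) conj(g_k(r)) Ψ_r(|f_{∖j}⟩⟨g_{∖k}|)`, where `f_{∖j}` is the wedge product
of all `f_i` with `i ≠ j`. -/
def integrand {m n : ℕ} (f : Fin (m + 1) → OneParticle) (g : Fin (n + 1) → OneParticle)
    (j : Fin (m + 1)) (k : Fin (n + 1)) (r : ℝ≥0) : Fock →L[ℂ] Fock :=
  (f j r * conj (g k r)) •
    preShiftSemigroup r (ketBra (wedge fun i => f (j.succAbove i)) (wedge fun i => g (k.succAbove i)))

/-- `L` is a linear map of `𝔖₁(F(H))`, bounded in the nuclear norm, which is given on rank-one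
operators by `|f⟩⟨g| ↦ ∑_{j,k} (-1)^{j+k} ∫_B f_j(r) conj(g_k(r)) Ψ_r(|f_{∖j}⟩⟨g_{∖k}|) dr`, and by
`0` if one of the two vectors is the vacuum. The integral is a Bochner integral of operators; as the
integrand takes values in multiples of rank-one operators depending continuously on `r`, taking it in
the operator norm or in the nuclear norm gives the same operator. -/
structure IsPreadjointMap (B : Set ℝ≥0) (L : nuclear Fock →ₗ[ℂ] nuclear Fock) : Prop where
  bounded : ∃ C : ℝ, ∀ ρ : nuclear Fock,
    nuclearNorm (L ρ : Fock →L[ℂ] Fock) ≤ C * nuclearNorm (ρ : Fock →L[ℂ] Fock)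
  map_wedge : ∀ (m n : ℕ) (f : Fin (m + 1) → OneParticle) (g : Fin (n + 1) → OneParticle),
    (L (nuclearKetBra (wedge f) (wedge g)) : Fock →L[ℂ] Fock) =
      ∑ j : Fin (m + 1), ∑ k : Fin (n + 1), (-1 : ℂ) ^ ((j : ℕ) + (k : ℕ)) • ∫ r in B, integrand f g j k r ∂lebesgue
  map_vacuum_left : ∀ (n : ℕ) (g : Fin n → OneParticle),
    L (nuclearKetBra vacuum (wedge g)) = 0
  map_vacuum_right : ∀ (n : ℕ) (f : Fin n → OneParticle),
    L (nuclearKetBra (wedge f) vacuum) = 0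

end ShiftCAR

end

open MeasureTheory NNReal ContinuousLinearMap
open scoped ComplexConjugate InnerProductSpace ENNReal CStarAlgebra

noncomputable section

namespace ShiftCAR

/-! The double sum in the formula for the preadjoint factorises. Put `a_f(r) = ∑_j (-1)^j f_j(r)
Ŝ_r^* f_{∖j}` (`annihilate`); then the integrand, summed over `j` and `k` with its signs, is the
single rank-one operator `|a_f(r)⟩⟨a_g(r)|` (`ketBra_annihilate`). So everything reduces to showing
that `f ↦ a_f` extends to a contraction `V` from the Fock space to `L²(ℝ₊; F(H))`.

For this the Gram matrices are compared. The inner product of `S_r^* f_i` and `S_r^* g_j` is the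
tail integral of `conj(f_i) g_j` over `[r, ∞)`, hence `⟪a_f(r), a_g(r)⟫` is a signed sum of entries
times minors: formally minus the `r`-derivative of the determinant of tail integrals. Integrating
over `r` gives the determinant at `r = 0`, which is `⟪f, g⟫` (`integral_det_tail`,
`integral_inner_annihilate`). The vacuum is sent to `0`, so `V` has the Gram matrix of the
projection onto the orthogonal complement of the vacuum and is a contraction
(`exists_contraction_of_gram`, `exists_annihilation`).

With `V_B` the restriction of `V` to `B`, the measure is `𝓜(B)(x) = V_B^* (1 ⊗ x) V_B`. Complete
positivity and subunitality follow from this form, and σ-additivity from the `L¹` density `⟪V v, x V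
u⟫`. Slicing `V_B` along a Hilbert basis of the scalar `L²` space gives Kraus operators `A_l`, and
`ρ ↦ ∑ A_l ρ A_l^*` is the preadjoint (`IsKrausFamily.map`, `trace_map_comp`): positive, and bounded
by `1` in the nuclear norm. Uniqueness of the preadjoint holds because the vectors `f₁ ∧ … ∧ fₙ` are
total (`nuclear_linearMap_ext`). Covariance reflects `S_r^* S_s^* = S_{r+s}^*`, by which
left-shifting all `f_i` by `s` turns `a_f(r)` into `a_f(r + s)` (`annihilate_shiftAdj`). -/

theorem tsum_mul_le_of_tsum_sq_le {ι : Type*} {f g : ι → ℝ} {a b : ℝ} (hf : ∀ i, 0 ≤ f i)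
    (hg : ∀ i, 0 ≤ g i) (ha : 0 ≤ a) (hb : 0 ≤ b) (hfs : Summable fun i => f i ^ 2)
    (hfa : ∑' i, f i ^ 2 ≤ a ^ 2) (hgs : Summable fun i => g i ^ 2)
    (hgb : ∑' i, g i ^ 2 ≤ b ^ 2) :
    (Summable fun i => f i * g i) ∧ ∑' i, f i * g i ≤ a * b := by
  have h := Real.summable_and_inner_le_Lp_mul_Lq_tsum_of_nonneg Real.HolderConjugate.two_two hf hg
    (by simpa using hfs) (by simpa using hgs)
  refine ⟨h.1, h.2.trans ?_⟩
  simp only [Real.rpow_ofNat, ← Real.sqrt_eq_rpow]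
  exact mul_le_mul (Real.sqrt_le_iff.2 ⟨ha, hfa⟩) (Real.sqrt_le_iff.2 ⟨hb, hgb⟩)
    (Real.sqrt_nonneg _) ha

/-! ### Nuclear norm and trace through rank-one expansions -/

section NuclearTheory

variable {E : Type*} [NormedAddCommGroup E] [InnerProductSpace ℂ E]

/-- `T = ∑ᵢ |uᵢ⟩⟨vᵢ|` with `∑ᵢ ‖uᵢ‖ ‖vᵢ‖ < ∞`, for an arbitrary index set. -/
def IsRankOneSum {κ : Type*} (T : E →L[ℂ] E) (u v : κ → E) : Prop :=
  Summable (fun i => ‖u i‖ * ‖v i‖) ∧ HasSum (fun i => ketBra (u i) (v i)) T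

theorem IsNuclearRep.isRankOneSum {T : E →L[ℂ] E} {u v : ℕ → E} (h : IsNuclearRep T u v) :
    IsRankOneSum T u v := h

/-- An absolutely summable family has countable support, which injects into `ℕ`; the other indices
get the value `0`. This allows expansions indexed by products, as Kraus sums produce. -/
theorem exists_isNuclearRep_of_hasSum {ι : Type*} {T : E →L[ℂ] E} {u v : ι → E}
    (hs : Summable fun i => ‖u i‖ * ‖v i‖) (hT : HasSum (fun i => ketBra (u i) (v i)) T) :
    ∃ u' v' : ℕ → E, IsNuclearRep T u' v' ∧
      ∑' i, ‖u' i‖ * ‖v' i‖ = ∑' i, ‖u i‖ * ‖v i‖ := by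
  set S : Set ι := Function.support fun i => ‖u i‖ * ‖v i‖ with hS
  have hSc : Countable S := hs.countable_support
  obtain ⟨e, he⟩ := exists_injective_nat S
  have hval : Function.Injective ((↑) : S → ι) := Subtype.val_injective
  have h0 : ∀ x ∉ Set.range ((↑) : S → ι), ‖u x‖ * ‖v x‖ = 0 := by
    intro x hx
    rw [Subtype.range_coe] at hx
    exact Function.notMem_support.1 hx
  have h0' : ∀ x ∉ Set.range ((↑) : S → ι), ketBra (u x) (v x) = 0 := by
    intro x hx
    rw [← norm_eq_zero, InnerProductSpace.norm_rankOne]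
    exact h0 x hx
  have hu : ∀ i : S, Function.extend e (fun i : S => u i) 0 (e i) = u i := fun i =>
    he.extend_apply _ _ _
  have hv : ∀ i : S, Function.extend e (fun i : S => v i) 0 (e i) = v i := fun i =>
    he.extend_apply _ _ _
  have hn : ∀ x ∉ Set.range e, Function.extend e (fun i : S => u i) 0 x = 0 := fun x hx =>
    Function.extend_apply' _ _ _ hx
  have key : HasSum (fun x => ‖Function.extend e (fun i : S => u i) 0 x‖ *
      ‖Function.extend e (fun i : S => v i) 0 x‖) (∑' i, ‖u i‖ * ‖v i‖) := by
    rw [← he.hasSum_iff fun x hx => by simp [hn x hx]]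
    simp only [Function.comp_def, hu, hv]
    exact (hval.hasSum_iff (f := fun i => ‖u i‖ * ‖v i‖) h0).2 hs.hasSum
  refine ⟨Function.extend e (fun i : S => u i) 0, Function.extend e (fun i : S => v i) 0,
    ⟨key.summable, ?_⟩, key.tsum_eq⟩
  rw [← he.hasSum_iff fun x hx => by simp [hn x hx]]
  simp only [Function.comp_def, hu, hv]
  exact (hval.hasSum_iff (f := fun i => ketBra (u i) (v i)) h0').2 hT

theorem nuclearNorm_bddBelow (T : E →L[ℂ] E) :
    BddBelow {c | ∃ u v : ℕ → E, IsNuclearRep T u v ∧ c = ∑' i, ‖u i‖ * ‖v i‖} := by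
  refine ⟨0, ?_⟩
  rintro _ ⟨u, v, _, rfl⟩
  exact tsum_nonneg fun i => by positivity

theorem nuclearNorm_le_of_hasSum {ι : Type*} {T : E →L[ℂ] E} {u v : ι → E}
    (hs : Summable fun i => ‖u i‖ * ‖v i‖) (hT : HasSum (fun i => ketBra (u i) (v i)) T) :
    nuclearNorm T ≤ ∑' i, ‖u i‖ * ‖v i‖ := by
  obtain ⟨u', v', h, h'⟩ := exists_isNuclearRep_of_hasSum hs hT
  exact csInf_le (nuclearNorm_bddBelow T) ⟨u', v', h, h'.symm⟩

theorem IsNuclear.le_nuclearNorm {T : E →L[ℂ] E} (hT : IsNuclear T) {c : ℝ}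
    (h : ∀ u v : ℕ → E, IsNuclearRep T u v → c ≤ ∑' i, ‖u i‖ * ‖v i‖) : c ≤ nuclearNorm T := by
  obtain ⟨u, v, h0⟩ := hT
  refine le_csInf ⟨_, u, v, h0, rfl⟩ ?_
  rintro _ ⟨u, v, h1, rfl⟩
  exact h u v h1

theorem IsNuclear.norm_le_nuclearNorm {T : E →L[ℂ] E} (hT : IsNuclear T) :
    ‖T‖ ≤ nuclearNorm T := by
  refine hT.le_nuclearNorm fun u v h => ?_
  rw [← h.2.tsum_eq]
  refine (norm_tsum_le_tsum_norm ?_).trans_eq ?_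
  · simp [h.1]
  · simp

theorem nuclearNorm_nonneg (T : E →L[ℂ] E) : 0 ≤ nuclearNorm T := by
  refine Real.sInf_nonneg ?_
  rintro _ ⟨u, v, _, rfl⟩
  exact tsum_nonneg fun i => by positivity

theorem nuclearNorm_ketBra_le (u v : E) : nuclearNorm (ketBra u v) ≤ ‖u‖ * ‖v‖ := by
  have := nuclearNorm_le_of_hasSum (ι := Unit) (T := ketBra u v) (u := fun _ => u) (v := fun _ => v)
    (hasSum_fintype _).summable (by simp)
  simpa using this

theorem IsNuclearRep.nuclearNorm_sub_le {T : E →L[ℂ] E} {u v : ℕ → E} (h : IsNuclearRep T u v)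
    (n : ℕ) : nuclearNorm (T - ∑ i ∈ Finset.range n, ketBra (u i) (v i)) ≤
      ∑' i, ‖u (i + n)‖ * ‖v (i + n)‖ := by
  refine nuclearNorm_le_of_hasSum (u := fun i => u (i + n)) (v := fun i => v (i + n))
    ((summable_nat_add_iff (f := fun i => ‖u i‖ * ‖v i‖) n).2 h.1) ?_
  exact (hasSum_nat_add_iff' (f := fun i => ketBra (u i) (v i)) n).2 h.2

theorem IsRankOneSum.comp_left {κ : Type*} {T : E →L[ℂ] E} {u v : κ → E}
    (h : IsRankOneSum T u v)
    (x : E →L[ℂ] E) : IsRankOneSum (x ∘L T) (fun i => x (u i)) v := by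
  refine ⟨(h.1.mul_left ‖x‖).of_nonneg_of_le (fun i => by positivity) fun i => ?_, ?_⟩
  · rw [← mul_assoc]
    gcongr
    exact x.le_opNorm _
  · have := h.2.mapL ((ContinuousLinearMap.compL ℂ E E E) x)
    simpa [InnerProductSpace.comp_rankOne] using this

theorem isRankOneSum_ketBra (u v : E) :
    IsRankOneSum (ketBra u v) (fun _ : Unit => u) fun _ => v :=
  ⟨(hasSum_fintype _).summable, by simp⟩

/-- For a nuclear operator the diagonal matrix elements along any Hilbert basis sum to
`∑ᵢ ⟪vᵢ, uᵢ⟫`. -/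
theorem IsRankOneSum.hasSum_inner {κ : Type*} {T : E →L[ℂ] E} {u v : κ → E}
    (h : IsRankOneSum T u v)
    {ι : Type*} (b : HilbertBasis ι ℂ E) :
    HasSum (fun i => ⟪b i, T (b i)⟫_ℂ) (∑' i, ⟪v i, u i⟫_ℂ) := by
  -- Parseval and Cauchy–Schwarz bound each fibre over `κ` by `‖u n‖ * ‖v n‖`, so this double series
  -- converges absolutely. Summing first over `ι` gives the inner products, first over `κ` the
  -- diagonal elements of `T`.
  set F : κ × ι → ℂ := fun p => ⟪v p.1, b p.2⟫_ℂ * ⟪b p.2, u p.1⟫_ℂ with hF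
  have hfib : ∀ n, Summable fun i => ‖F (n, i)‖ := fun n =>
    (b.summable_inner_mul_inner (v n) (u n)).norm
  have hbd : ∀ n, ∑' i, ‖F (n, i)‖ ≤ ‖u n‖ * ‖v n‖ := by
    intro n
    have h1 : ∀ z : E, HasSum (fun i => ‖⟪b i, z⟫_ℂ‖ ^ 2) (‖z‖ ^ 2) := by
      intro z
      have h2 := (b.hasSum_inner_mul_inner z z).mapL Complex.reCLM
      convert h2 using 1
      · ext i
        rw [← inner_conj_symm z (b i), Complex.conj_mul']
        simp only [Complex.reCLM_apply]
        norm_cast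
      · simp only [Complex.reCLM_apply]
        rw [inner_self_eq_norm_sq_to_K]
        norm_cast
    refine le_trans (le_of_eq (tsum_congr fun i => ?_)) (tsum_mul_le_of_tsum_sq_le
      (f := fun i => ‖⟪b i, u n⟫_ℂ‖) (g := fun i => ‖⟪b i, v n⟫_ℂ‖)
      (fun i => norm_nonneg _) (fun i => norm_nonneg _) (norm_nonneg _) (norm_nonneg _)
      (h1 _).summable (h1 _).tsum_eq.le (h1 _).summable (h1 _).tsum_eq.le).2
    rw [hF, norm_mul, norm_inner_symm, mul_comm]
  have hsum : Summable F := by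
    refine Summable.of_norm ((summable_prod_of_nonneg fun p => norm_nonneg _).2 ⟨hfib, ?_⟩)
    exact h.1.of_nonneg_of_le (fun n => tsum_nonneg fun i => norm_nonneg _) hbd
  have h2 : HasSum F (∑' n, ⟪v n, u n⟫_ℂ) := by
    have h4 := hsum.hasSum
    have h5 := h4.prod_fiberwise fun n => b.hasSum_inner_mul_inner (v n) (u n)
    rwa [← h5.tsum_eq] at h4
  have h6 := ((Equiv.prodComm ι κ).hasSum_iff).2 h2
  refine h6.prod_fiberwise fun i => ?_
  have h7 := (h.2.mapL (ContinuousLinearMap.apply ℂ E (b i))).mapL (innerSL ℂ (b i))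
  simpa [hF, inner_smul_right] using h7

theorem IsRankOneSum.summable_inner {κ : Type*} {T : E →L[ℂ] E} {u v : κ → E}
    (h : IsRankOneSum T u v)
    (x : E →L[ℂ] E) : Summable fun i => ⟪v i, x (u i)⟫_ℂ := by
  refine .of_norm_bounded (h.comp_left x).1 fun i => ?_
  rw [mul_comm]
  exact norm_inner_le_norm _ _

theorem IsRankOneSum.isNuclear {κ : Type*} {T : E →L[ℂ] E} {u v : κ → E}
    (h : IsRankOneSum T u v) : IsNuclear T := by
  obtain ⟨u', v', h', _⟩ := exists_isNuclearRep_of_hasSum h.1 h.2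
  exact ⟨u', v', h'⟩

variable [CompleteSpace E]

theorem IsRankOneSum.comp_right {κ : Type*} {T : E →L[ℂ] E} {u v : κ → E}
    (h : IsRankOneSum T u v)
    (x : E →L[ℂ] E) : IsRankOneSum (T ∘L x) u (fun i => adjoint x (v i)) := by
  refine ⟨(h.1.mul_left ‖adjoint x‖).of_nonneg_of_le (fun i => by positivity) fun i => ?_, ?_⟩
  · rw [mul_left_comm]
    gcongr
    exact (adjoint x).le_opNorm _
  · have := h.2.mapL ((ContinuousLinearMap.compL ℂ E E E).flip x)
    simpa [InnerProductSpace.rankOne_comp] using this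

theorem IsRankOneSum.hasSum_trace {κ : Type*} {T : E →L[ℂ] E} {u v : κ → E}
    (h : IsRankOneSum T u v) :
    HasSum (fun e : (exists_hilbertBasis ℂ E).choose => ⟪(e : E), T (e : E)⟫_ℂ)
      (∑' i, ⟪v i, u i⟫_ℂ) := by
  obtain ⟨b, hb⟩ := (exists_hilbertBasis ℂ E).choose_spec
  have := h.hasSum_inner b
  rw [hb] at this
  exact this

theorem IsRankOneSum.trace_eq {κ : Type*} {T : E →L[ℂ] E} {u v : κ → E}
    (h : IsRankOneSum T u v) :
    trace T = ∑' i, ⟪v i, u i⟫_ℂ := h.hasSum_trace.tsum_eq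

theorem IsRankOneSum.trace_comp {κ : Type*} {T : E →L[ℂ] E} {u v : κ → E}
    (h : IsRankOneSum T u v)
    (x : E →L[ℂ] E) : trace (T ∘L x) = ∑' i, ⟪v i, x (u i)⟫_ℂ := by
  rw [(h.comp_right x).trace_eq]
  simp [adjoint_inner_left]

theorem trace_ketBra_comp (u v : E) (x : E →L[ℂ] E) :
    trace (ketBra u v ∘L x) = ⟪v, x u⟫_ℂ := by
  simp [(isRankOneSum_ketBra u v).trace_comp]

/-- Turns trace duality into matrix elements: a nuclear operator known only through its traces
against bounded operators can be read off from rank-one test operators. -/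
theorem IsNuclear.trace_comp_ketBra {T : E →L[ℂ] E} (hT : IsNuclear T) (u v : E) :
    trace (T ∘L ShiftCAR.ketBra u v) = ⟪v, T u⟫_ℂ := by
  obtain ⟨a, b, h⟩ := hT
  replace h := h.isRankOneSum
  rw [h.trace_comp]
  have h7 := (h.2.mapL (ContinuousLinearMap.apply ℂ E u)).mapL (innerSL ℂ v)
  simp only [ContinuousLinearMap.apply_apply, InnerProductSpace.rankOne_apply, innerSL_apply_apply,
    inner_smul_right] at h7 ⊢
  rw [← h7.tsum_eq]
  exact tsum_congr fun i => mul_comm _ _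

theorem IsNuclear.re_trace_nonneg {T : E →L[ℂ] E} (hT : IsNuclear T) (h0 : 0 ≤ T) :
    0 ≤ (trace T).re := by
  obtain ⟨a, b, h⟩ := hT
  replace h := h.isRankOneSum
  have h1 := h.hasSum_trace
  rw [← h.trace_eq] at h1
  have h2 := h1.mapL Complex.reCLM
  refine h2.nonneg fun e => ?_
  exact (ContinuousLinearMap.nonneg_iff_isPositive T |>.1 h0).re_inner_nonneg_right e

/-- With `x = y^* y`, cyclicity of the trace gives `Tr(T y^* y) = Tr(y T y^*)`, and `y T y^*` is
positive. -/
theorem IsNuclear.re_trace_comp_nonneg {T : E →L[ℂ] E} (hT : IsNuclear T) (h0 : 0 ≤ T)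
    {x : E →L[ℂ] E} (hx : 0 ≤ x) : 0 ≤ (trace (T ∘L x)).re := by
  obtain ⟨a, b, h⟩ := hT
  replace h := h.isRankOneSum
  obtain ⟨y, rfl⟩ := CStarAlgebra.nonneg_iff_eq_star_mul_self.1 hx
  have h1 := (h.comp_left y).comp_right (adjoint y)
  have h2 : trace (T ∘L (star y * y)) = trace ((y ∘L T) ∘L adjoint y) := by
    rw [h.trace_comp, h1.trace_eq]
    refine tsum_congr fun i => ?_
    simp [star_eq_adjoint, adjoint_inner_right, mul_def]
  rw [h2]
  refine IsNuclear.re_trace_nonneg ⟨_, _, h1⟩ ?_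
  rw [ContinuousLinearMap.nonneg_iff_isPositive] at h0 ⊢
  exact h0.conj_adjoint y

end NuclearTheory

/-! ### Kraus maps on the nuclear operators, and uniqueness of bounded maps -/

section Kraus

variable {E : Type*} [NormedAddCommGroup E] [InnerProductSpace ℂ E] {ι : Type*}

/-- A family of operators with `∑ₗ Aₗ^* Aₗ ≤ 1`. -/
def IsKrausFamily (A : ι → E →L[ℂ] E) : Prop :=
  ∀ x, Summable (fun l => ‖A l x‖ ^ 2) ∧ ∑' l, ‖A l x‖ ^ 2 ≤ ‖x‖ ^ 2

namespace IsKrausFamily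

variable {A : ι → E →L[ℂ] E}

theorem summable_mul (hA : IsKrausFamily A) (x y : E) :
    (Summable fun l => ‖A l x‖ * ‖A l y‖) ∧ ∑' l, ‖A l x‖ * ‖A l y‖ ≤ ‖x‖ * ‖y‖ :=
  tsum_mul_le_of_tsum_sq_le (fun _ => norm_nonneg _) (fun _ => norm_nonneg _) (norm_nonneg _)
    (norm_nonneg _) (hA x).1 (hA x).2 (hA y).1 (hA y).2

theorem summable_prod (hA : IsKrausFamily A) {κ : Type*} {u v : κ → E}
    (h : Summable fun i => ‖u i‖ * ‖v i‖) :
    Summable (fun p : κ × ι => ‖A p.2 (u p.1)‖ * ‖A p.2 (v p.1)‖) := by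
  refine (summable_prod_of_nonneg fun p => by positivity).2
    ⟨fun i => (hA.summable_mul (u i) (v i)).1, ?_⟩
  exact h.of_nonneg_of_le (fun n => tsum_nonneg fun i => by positivity)
    fun i => (hA.summable_mul (u i) (v i)).2

theorem tsum_prod_le (hA : IsKrausFamily A) {κ : Type*} {u v : κ → E}
    (h : Summable fun i => ‖u i‖ * ‖v i‖) :
    ∑' p : κ × ι, ‖A p.2 (u p.1)‖ * ‖A p.2 (v p.1)‖ ≤ ∑' i, ‖u i‖ * ‖v i‖ := by
  rw [(hA.summable_prod h).tsum_prod]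
  exact (hA.summable_prod h).prod.tsum_le_tsum (fun i => (hA.summable_mul (u i) (v i)).2) h

variable [CompleteSpace E]

theorem conj_ketBra (B : E →L[ℂ] E) (u v : E) :
    B ∘L ketBra u v ∘L adjoint B = ketBra (B u) (B v) := by
  rw [InnerProductSpace.rankOne_comp, InnerProductSpace.comp_rankOne, adjoint_adjoint]

/-- Conjugation by `A l` sends `|u⟩⟨v|` to `|A l u⟩⟨A l v|`. By Cauchy–Schwarz in `l`, the resulting
double family has total mass at most `∑ ‖u i‖ * ‖v i‖`, so the order of summation is free. -/
theorem isRankOneSum_prod (hA : IsKrausFamily A) {κ : Type*} {T : E →L[ℂ] E} {u v : κ → E}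
    (h : IsRankOneSum T u v) :
    IsRankOneSum (∑' l, A l ∘L T ∘L adjoint (A l)) (fun p : κ × ι => A p.2 (u p.1))
      (fun p => A p.2 (v p.1)) ∧ Summable fun l => A l ∘L T ∘L adjoint (A l) := by
  have hs := hA.summable_prod h.1
  have h1 : Summable fun p : κ × ι => ketBra (A p.2 (u p.1)) (A p.2 (v p.1)) :=
    .of_norm (by simpa using hs)
  have h2 := ((Equiv.prodComm ι κ).hasSum_iff).2 h1.hasSum
  have h3 := h2.prod_fiberwise (g := fun l => A l ∘L T ∘L adjoint (A l)) fun l => by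
    have h4 := h.2.mapL ((ContinuousLinearMap.compL ℂ E E E (A l)) ∘L
      ((ContinuousLinearMap.compL ℂ E E E).flip (adjoint (A l))))
    exact (funext fun i => conj_ketBra (A l) (u i) (v i)) ▸ h4
  refine ⟨⟨hs, ?_⟩, h3.summable⟩
  rw [h3.tsum_eq]
  exact h1.hasSum

/-- The map `ρ ↦ ∑ₗ Aₗ ρ Aₗ^*` of the nuclear operators. -/
def map (hA : IsKrausFamily A) : nuclear E →ₗ[ℂ] nuclear E where
  toFun ρ := ⟨∑' l, A l ∘L (ρ : E →L[ℂ] E) ∘L adjoint (A l), by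
    obtain ⟨u, v, h⟩ := ρ.2
    exact (hA.isRankOneSum_prod h.isRankOneSum).1.isNuclear⟩
  map_add' ρ σ := by
    obtain ⟨u, v, h⟩ := ρ.2
    obtain ⟨u', v', h'⟩ := σ.2
    refine Subtype.ext ?_
    change ∑' l, A l ∘L ((ρ : E →L[ℂ] E) + (σ : E →L[ℂ] E)) ∘L adjoint (A l) = _ + _
    rw [← (hA.isRankOneSum_prod h.isRankOneSum).2.tsum_add
      (hA.isRankOneSum_prod h'.isRankOneSum).2]
    exact tsum_congr fun l => by simp [add_comp, comp_add]
  map_smul' c ρ := by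
    refine Subtype.ext ?_
    change ∑' l, A l ∘L (c • (ρ : E →L[ℂ] E)) ∘L adjoint (A l) = c • _
    rw [← tsum_const_smul'']
    exact tsum_congr fun l => by simp [smul_comp]

theorem coe_map (hA : IsKrausFamily A) (ρ : nuclear E) :
    (hA.map ρ : E →L[ℂ] E) = ∑' l, A l ∘L (ρ : E →L[ℂ] E) ∘L adjoint (A l) := rfl

theorem nuclearNorm_map_le (hA : IsKrausFamily A) (ρ : nuclear E) :
    nuclearNorm (hA.map ρ : E →L[ℂ] E) ≤ nuclearNorm (ρ : E →L[ℂ] E) := by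
  refine IsNuclear.le_nuclearNorm ρ.2 fun u v h => ?_
  have h1 := (hA.isRankOneSum_prod h.isRankOneSum).1
  exact (nuclearNorm_le_of_hasSum h1.1 h1.2).trans (hA.tsum_prod_le h.1)

theorem map_nonneg (hA : IsKrausFamily A) {ρ : nuclear E} (h0 : 0 ≤ (ρ : E →L[ℂ] E)) :
    0 ≤ (hA.map ρ : E →L[ℂ] E) := by
  refine tsum_nonneg fun l => ?_
  rw [ContinuousLinearMap.nonneg_iff_isPositive] at h0 ⊢
  exact h0.conj_adjoint (A l)

/-- The hypothesis `hM` says that `M x = ∑ A_l^* x A_l` weakly; both traces are then the same double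
series over a rank-one expansion of `ρ`. -/
theorem trace_map_comp (hA : IsKrausFamily A) {M : (E →L[ℂ] E) → (E →L[ℂ] E)}
    (hM : ∀ x u v, HasSum (fun l => ⟪A l v, x (A l u)⟫_ℂ) ⟪v, M x u⟫_ℂ) (ρ : nuclear E)
    (x : E →L[ℂ] E) :
    trace ((hA.map ρ : E →L[ℂ] E) ∘L x) = trace ((ρ : E →L[ℂ] E) ∘L M x) := by
  obtain ⟨u, v, h⟩ := ρ.2
  have h1 := (hA.isRankOneSum_prod h.isRankOneSum).1
  rw [coe_map, h1.trace_comp, h.isRankOneSum.trace_comp, (h1.summable_inner x).tsum_prod]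
  exact tsum_congr fun i => (hM x (u i) (v i)).tsum_eq

end IsKrausFamily

theorem eq_of_trace_comp_eq [CompleteSpace E] {N N' : (E →L[ℂ] E) → (E →L[ℂ] E)}
    (h : ∀ (ρ : nuclear E) (x : E →L[ℂ] E),
      trace ((ρ : E →L[ℂ] E) ∘L N x) = trace ((ρ : E →L[ℂ] E) ∘L N' x)) : N = N' := by
  funext x
  refine ContinuousLinearMap.ext fun u => ext_inner_left ℂ fun v => ?_
  have := h (nuclearKetBra u v) x
  simpa only [nuclearKetBra, trace_ketBra_comp] using this

/-- Two linear maps of the nuclear operators that are bounded in the nuclear norm are equal if they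
agree on `|u⟩⟨v|` for `u`, `v` in a total set. -/
theorem nuclear_linearMap_ext {L L' : nuclear E →ₗ[ℂ] nuclear E} {κ : Type*} {w : κ → E}
    (hw : (Submodule.span ℂ (Set.range w)).topologicalClosure = ⊤)
    (hL : ∃ C : ℝ, ∀ ρ : nuclear E,
      nuclearNorm (L ρ : E →L[ℂ] E) ≤ C * nuclearNorm (ρ : E →L[ℂ] E))
    (hL' : ∃ C : ℝ, ∀ ρ : nuclear E,
      nuclearNorm (L' ρ : E →L[ℂ] E) ≤ C * nuclearNorm (ρ : E →L[ℂ] E))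
    (h : ∀ i j, L (nuclearKetBra (w i) (w j)) = L' (nuclearKetBra (w i) (w j))) : L = L' := by
  obtain ⟨C, hC⟩ := hL
  obtain ⟨C', hC'⟩ := hL'
  have hD : ∀ ρ : nuclear E, ‖((L - L') ρ : E →L[ℂ] E)‖ ≤ (|C| + |C'|) * nuclearNorm (ρ : E →L[ℂ] E) := by
    intro ρ
    have h1 : ‖(L ρ : E →L[ℂ] E)‖ ≤ |C| * nuclearNorm (ρ : E →L[ℂ] E) :=
      (IsNuclear.norm_le_nuclearNorm (L ρ).2).trans ((hC ρ).trans
        (mul_le_mul_of_nonneg_right (le_abs_self C) (nuclearNorm_nonneg _)))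
    have h2 : ‖(L' ρ : E →L[ℂ] E)‖ ≤ |C'| * nuclearNorm (ρ : E →L[ℂ] E) :=
      (IsNuclear.norm_le_nuclearNorm (L' ρ).2).trans ((hC' ρ).trans
        (mul_le_mul_of_nonneg_right (le_abs_self C') (nuclearNorm_nonneg _)))
    rw [add_mul]
    exact (norm_sub_le _ _).trans (add_le_add h1 h2)
  have h0 : ∀ i j, (L - L') (nuclearKetBra (w i) (w j)) = 0 := fun i j => sub_eq_zero.2 (h i j)
  rw [← sub_eq_zero]
  have hK : 0 ≤ |C| + |C'| := by positivity
  -- Only two facts about the difference matter from here on: it is bounded from the nuclear norm to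
  -- the operator norm, and it vanishes on the given rank-one operators.
  generalize L - L' = D, |C| + |C'| = K at hD hK h0
  have hdense : Dense (Submodule.span ℂ (Set.range w) : Set E) := by
    rwa [Submodule.dense_iff_topologicalClosure_eq_top]
  have hbd : ∀ u v, ‖(D (nuclearKetBra u v) : E →L[ℂ] E)‖ ≤ K * ‖u‖ * ‖v‖ := fun u v =>
    (hD _).trans ((mul_le_mul_of_nonneg_left (nuclearNorm_ketBra_le u v) hK).trans_eq
      (mul_assoc _ _ _).symm)
  have hadd : ∀ u u' v : E, nuclearKetBra (u + u') v = nuclearKetBra u v + nuclearKetBra u' v :=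
    fun u u' v => Subtype.ext (ContinuousLinearMap.ext fun z => by simp [nuclearKetBra, smul_add])
  have hadd' : ∀ u v v' : E, nuclearKetBra u (v + v') = nuclearKetBra u v + nuclearKetBra u v' :=
    fun u v v' => Subtype.ext (by simp [nuclearKetBra])
  have hsmul : ∀ (c : ℂ) (u v : E), nuclearKetBra (c • u) v = c • nuclearKetBra u v :=
    fun c u v => Subtype.ext (ContinuousLinearMap.ext fun z => smul_comm _ _ _)
  have hsmul' : ∀ (c : ℂ) (u v : E), nuclearKetBra u (c • v) = conj c • nuclearKetBra u v :=
    fun c u v => Subtype.ext (by simp [nuclearKetBra])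
  -- Density is used in one vector at a time: first in the ket, where the dependence is linear, then
  -- in the bra, where it is conjugate-linear.
  have h1 : ∀ u j, D (nuclearKetBra u (w j)) = 0 := by
    intro u j
    let F : E →L[ℂ] (E →L[ℂ] E) := LinearMap.mkContinuous
      { toFun := fun u => (D (nuclearKetBra u (w j)) : E →L[ℂ] E)
        map_add' := fun a b => by simp [hadd]
        map_smul' := fun c a => by simp [hsmul] } (K * ‖w j‖) fun u => by
      simpa [mul_right_comm] using hbd u (w j)
    have hF : F = 0 := ContinuousLinearMap.ext_on hdense (by
      rintro _ ⟨i, rfl⟩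
      exact congrArg Subtype.val (h0 i j))
    exact Subtype.ext (congrArg (fun G : E →L[ℂ] (E →L[ℂ] E) => G u) hF)
  have h2 : ∀ u v, D (nuclearKetBra u v) = 0 := by
    intro u v
    let F : E →L⋆[ℂ] (E →L[ℂ] E) := LinearMap.mkContinuous
      { toFun := fun v => (D (nuclearKetBra u v) : E →L[ℂ] E)
        map_add' := fun a b => by simp [hadd']
        map_smul' := fun c a => by simp [hsmul'] } (K * ‖u‖) fun v => hbd u v
    have hF : F = 0 := ContinuousLinearMap.ext_on hdense (by
      rintro _ ⟨j, rfl⟩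
      exact congrArg Subtype.val (h1 u j))
    exact Subtype.ext (congrArg (fun G : E →L⋆[ℂ] (E →L[ℂ] E) => G v) hF)
  ext1 ρ
  obtain ⟨u, v, h⟩ := ρ.2
  -- `D` kills every finite partial sum of the expansion of `ρ`, so only the tail of the series
  -- contributes.
  have h3 : ∀ n, ‖(D ρ : E →L[ℂ] E)‖ ≤ K * ∑' i, ‖u (i + n)‖ * ‖v (i + n)‖ := by
    intro n
    have h4 : D ρ = D (ρ - ∑ i ∈ Finset.range n, nuclearKetBra (u i) (v i)) := by
      simp [map_sub, map_sum, h2]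
    rw [h4]
    refine (hD _).trans (mul_le_mul_of_nonneg_left ?_ hK)
    have h5 := h.nuclearNorm_sub_le n
    simpa [nuclearKetBra] using h5
  have h6 : Filter.Tendsto (fun n => K * ∑' i, ‖u (i + n)‖ * ‖v (i + n)‖) Filter.atTop
      (nhds (K * 0)) :=
    (tendsto_sum_nat_add fun i => ‖u i‖ * ‖v i‖).const_mul K
  have h7 := ge_of_tendsto' h6 h3
  rw [mul_zero, norm_le_zero_iff] at h7
  exact Subtype.ext h7

end Kraus

/-! ### Complete positivity of `x ↦ W^* π(x) W` -/

section CompletelyPositive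

theorem exists_eq_star_mul_self {A : Type*} [NonUnitalCStarAlgebra A] [PartialOrder A]
    [StarOrderedRing A] {a : A} (ha : 0 ≤ a) : ∃ b, a = star b * b :=
  CStarAlgebra.nonneg_iff_eq_star_mul_self.1 ha

/-- Positivity of `S^* S` in `B(E)` yields a factor `b` acting inside `E`. This removes the
auxiliary space `K`, as matrices over `B(E)` need entries in `B(E)`. -/
theorem exists_adjoint_comp_self_eq {E K : Type*} [NormedAddCommGroup E] [InnerProductSpace ℂ E]
    [CompleteSpace E] [NormedAddCommGroup K] [InnerProductSpace ℂ K] [CompleteSpace K]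
    (S : E →L[ℂ] K) : ∃ b : E →L[ℂ] E, ∀ x y, ⟪S x, S y⟫_ℂ = ⟪b x, b y⟫_ℂ := by
  have hpos : 0 ≤ adjoint S ∘L S := by
    rw [ContinuousLinearMap.nonneg_iff_isPositive]
    exact isPositive_adjoint_comp_self S
  obtain ⟨b, hb⟩ := exists_eq_star_mul_self hpos
  refine ⟨b, fun x y => ?_⟩
  have h3 := congrArg (fun L => ⟪x, L y⟫_ℂ) hb
  simpa only [ContinuousLinearMap.comp_apply, mul_apply_eq_comp, star_eq_adjoint,
    adjoint_inner_right] using h3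

variable {E K : Type*} [NormedAddCommGroup E] [InnerProductSpace ℂ E] [CompleteSpace E]
  [NormedAddCommGroup K] [InnerProductSpace ℂ K] [CompleteSpace K]

/-- The matrix `(Tᵢ^* Tⱼ)` of operators of `E` is positive, for operators `Tᵢ : E → K`. -/
theorem cstarMatrix_gram_nonneg {k : ℕ} (T : Fin k → E →L[ℂ] K) :
    (0 : CStarMatrix (Fin k) (Fin k) (E →L[ℂ] E)) ≤
      CStarMatrix.ofMatrix (Matrix.of fun i j => adjoint (T i) ∘L T j) := by
  let p : ∀ i : Fin k, PiLp 2 (fun _ : Fin k => E) →L[ℂ] E := fun i => PiLp.proj 2 (fun _ => E) i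
  -- The row operator `(T₁, …, T_k)` on `E^k`; the matrix in question consists of the blocks of `S^*
  -- S`. Writing `S^* S = b^* b` and cutting `b` into blocks gives `N` with `N^* N` equal to the
  -- matrix.
  let S : PiLp 2 (fun _ : Fin k => E) →L[ℂ] K := ∑ i, T i ∘L p i
  have hp : ∀ i j (x : E), p i (adjoint (p j) x) = if i = j then x else 0 := by
    intro i j x
    have h1 : adjoint (p j) x = WithLp.toLp 2 (Pi.single j x) := by
      refine ext_inner_right ℂ fun y => ?_
      rw [adjoint_inner_left, PiLp.inner_apply, Finset.sum_eq_single j]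
      · simp [p]
      · intro i _ hij
        simp [hij]
      · simp
    rw [h1]
    by_cases h : i = j
    · subst h; simp [p]
    · simp [p, h]
  have hS : ∀ j x, S (adjoint (p j) x) = T j x := by
    intro j x
    simp only [S, sum_apply, ContinuousLinearMap.comp_apply, hp]
    rw [Finset.sum_eq_single j]
    · simp
    · intro i _ hij
      simp [hij]
    · simp
  have hsum : ∀ x y : PiLp 2 (fun _ : Fin k => E), ∑ l, ⟪p l x, p l y⟫_ℂ = ⟪x, y⟫_ℂ := by
    intro x y
    rw [PiLp.inner_apply]
    rfl
  obtain ⟨b, hb⟩ := exists_adjoint_comp_self_eq S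
  let N : CStarMatrix (Fin k) (Fin k) (E →L[ℂ] E) :=
    CStarMatrix.ofMatrix (Matrix.of fun l i => p l ∘L b ∘L adjoint (p i))
  have hN : CStarMatrix.ofMatrix (Matrix.of fun i j => adjoint (T i) ∘L T j) = star N * N := by
    ext i j : 1
    refine ContinuousLinearMap.ext fun x => ?_
    refine ext_inner_left ℂ fun y => ?_
    have h1 : (star N * N) i j = ∑ l, star (N l i) * N l j := by
      rw [CStarMatrix.mul_apply]
      rfl
    have h2 := hb (adjoint (p i) y) (adjoint (p j) x)
    rw [h1]
    simp only [hS] at h2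
    simp only [sum_apply, inner_sum, mul_apply_eq_comp,
      star_eq_adjoint, adjoint_inner_right]
    rw [← hsum] at h2
    change ⟪y, adjoint (T i) (T j x)⟫_ℂ = _
    rw [adjoint_inner_right, h2]
    rfl
  rw [hN]
  exact star_mul_self_nonneg N

/-- The completely positive map `x ↦ W^* π(x) W`, for a multiplicative and involutive linear map
`π`. -/
def conjCP (π : (E →L[ℂ] E) →ₗ[ℂ] (K →L[ℂ] K)) (hmul : ∀ x y, π (x * y) = π x * π y)
    (hstar : ∀ x, π (star x) = star (π x)) (W : E →L[ℂ] K) : (E →L[ℂ] E) →CP (E →L[ℂ] E) where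
  toFun x := adjoint W ∘L π x ∘L W
  map_add' x y := by simp [add_comp, comp_add]
  map_smul' c x := by simp [smul_comp]
  map_cstarMatrix_nonneg' k M hM := by
    -- With the matrix written as `N^* N`, multiplicativity of `π` makes its image a sum over `l` of
    -- Gram matrices of the operators `π(N l i) W`.
    obtain ⟨N, rfl⟩ := exists_eq_star_mul_self hM
    have h : (star N * N).map (fun x : E →L[ℂ] E => adjoint W ∘L π x ∘L W) =
        ∑ l, CStarMatrix.ofMatrix (Matrix.of fun i j =>
          adjoint (π (N l i) ∘L W) ∘L (π (N l j) ∘L W)) := by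
      ext i j : 1
      have h1 : (star N * N) i j = ∑ l, star (N l i) * N l j := by
        rw [CStarMatrix.mul_apply]
        rfl
      rw [CStarMatrix.map_apply, h1]
      have h2 : ∀ F : Fin k → CStarMatrix (Fin k) (Fin k) (E →L[ℂ] E),
          (∑ l, F l) i j = ∑ l, F l i j := fun F =>
        map_sum (⟨⟨fun M => M i j, rfl⟩, fun _ _ => rfl⟩ :
          CStarMatrix (Fin k) (Fin k) (E →L[ℂ] E) →+ (E →L[ℂ] E)) F Finset.univ
      rw [h2]
      have h3 : ∀ x, π (adjoint x) = adjoint (π x) := hstar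
      refine ContinuousLinearMap.ext fun x => ?_
      simp only [map_sum, hmul, h3, ContinuousLinearMap.comp_apply, sum_apply,
        mul_apply_eq_comp, star_eq_adjoint, CStarMatrix.ofMatrix_apply, Matrix.of_apply,
        adjoint_comp]
    refine le_of_le_of_eq ?_ h.symm
    exact Finset.sum_nonneg fun l _ => cstarMatrix_gram_nonneg _

theorem conjCP_apply (π : (E →L[ℂ] E) →ₗ[ℂ] (K →L[ℂ] K)) (hmul : ∀ x y, π (x * y) = π x * π y)
    (hstar : ∀ x, π (star x) = star (π x)) (W : E →L[ℂ] K) (x : E →L[ℂ] E) (u : E) :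
    conjCP π hmul hstar W x u = adjoint W (π x (W u)) := rfl

end CompletelyPositive

/-! ### The space `L²(μ; E)` as a tensor product, and Kraus operators from slices -/

section VectorL2

variable {α : Type*} [MeasurableSpace α] {μ : Measure α}
  {E F G : Type*} [NormedAddCommGroup E] [InnerProductSpace ℂ E]
  [NormedAddCommGroup F] [InnerProductSpace ℂ F] [NormedAddCommGroup G] [InnerProductSpace ℂ G]

theorem compLpL_comp (x : F →L[ℂ] G) (y : E →L[ℂ] F) :
    (x ∘L y).compLpL 2 μ = x.compLpL 2 μ ∘L y.compLpL 2 μ := by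
  refine ContinuousLinearMap.ext fun φ => Lp.ext ?_
  filter_upwards [coeFn_compLpL (p := 2) (x ∘L y) φ, coeFn_compLpL (p := 2) y φ,
    coeFn_compLpL (p := 2) x (y.compLpL 2 μ φ)] with a h1 h2 h3
  rw [h1, ContinuousLinearMap.comp_apply, ContinuousLinearMap.comp_apply, h3, h2]

variable (μ) in
/-- The action `x ↦ 1 ⊗ x` of `B(E)` on `L²(μ; E)`. -/
def ampliation : (E →L[ℂ] E) →ₗ[ℂ] (Lp E 2 μ →L[ℂ] Lp E 2 μ) where
  toFun x := x.compLpL 2 μ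
  map_add' x y := add_compLpL x y
  map_smul' c x := smul_compLpL c x

theorem ampliation_apply (x : E →L[ℂ] E) : ampliation μ x = x.compLpL 2 μ := rfl

theorem ampliation_mul (x y : E →L[ℂ] E) :
    ampliation μ (x * y) = ampliation μ x * ampliation μ y := compLpL_comp x y

/-- The map `x ↦ η ⊗ x` from `E` to `L²(μ; E)`. -/
def tensorLeft (η : Lp ℂ 2 μ) : E →L[ℂ] Lp E 2 μ :=
  (compLpL₂ 2 μ (ContinuousLinearMap.lsmul ℂ ℂ).flip).flip η

theorem coeFn_tensorLeft (η : Lp ℂ 2 μ) (x : E) :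
    tensorLeft η x =ᵐ[μ] fun a => η a • x :=
  coeFn_compLpL _ _

theorem inner_tensorLeft (η ζ : Lp ℂ 2 μ) (x y : E) :
    ⟪tensorLeft η x, tensorLeft ζ y⟫_ℂ = ⟪η, ζ⟫_ℂ * ⟪x, y⟫_ℂ := by
  rw [L2.inner_def, L2.inner_def, ← integral_mul_const]
  refine integral_congr_ae ?_
  filter_upwards [coeFn_tensorLeft η x, coeFn_tensorLeft ζ y] with a h1 h2
  rw [h1, h2, inner_smul_left, inner_smul_right]
  simp [mul_assoc, mul_comm]

theorem tensorLeft_indicatorConstLp {s : Set α} (hs : MeasurableSet s) (hμs : μ s ≠ ∞) (c : E) :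
    tensorLeft (indicatorConstLp 2 hs hμs (1 : ℂ)) c = indicatorConstLp 2 hs hμs c := by
  refine Lp.ext ?_
  filter_upwards [coeFn_tensorLeft (indicatorConstLp 2 hs hμs (1 : ℂ)) c,
    indicatorConstLp_coeFn (p := 2) (hs := hs) (hμs := hμs) (c := (1 : ℂ)),
    indicatorConstLp_coeFn (p := 2) (hs := hs) (hμs := hμs) (c := c)] with a h1 h2 h3
  rw [h1, h2, h3]
  by_cases ha : a ∈ s <;> simp [ha]

theorem adjoint_compLpL [CompleteSpace E] [CompleteSpace F] (x : E →L[ℂ] F) :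
    adjoint (x.compLpL 2 μ) = (adjoint x).compLpL 2 μ := by
  symm
  rw [eq_adjoint_iff]
  intro φ ψ
  rw [L2.inner_def, L2.inner_def]
  refine integral_congr_ae ?_
  filter_upwards [coeFn_compLpL (p := 2) (adjoint x) φ, coeFn_compLpL (p := 2) x ψ] with a h1 h2
  rw [h1, h2, adjoint_inner_left]

variable [CompleteSpace E]

theorem ampliation_star (x : E →L[ℂ] E) : ampliation μ (star x) = star (ampliation μ x) :=
  (adjoint_compLpL x).symm

/-- The completely positive map `x ↦ W^* (1 ⊗ x) W`. -/
def ampliationCP (W : E →L[ℂ] Lp E 2 μ) : (E →L[ℂ] E) →CP (E →L[ℂ] E) :=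
  conjCP (ampliation μ) ampliation_mul ampliation_star W

theorem inner_ampliationCP (W : E →L[ℂ] Lp E 2 μ) (x : E →L[ℂ] E) (u v : E) :
    ⟪v, ampliationCP W x u⟫_ℂ = ⟪W v, x.compLpL 2 μ (W u)⟫_ℂ := by
  rw [ampliationCP, conjCP_apply, adjoint_inner_right, ampliation_apply]

theorem inner_ampliationCP_eq_integral (W : E →L[ℂ] Lp E 2 μ) (x : E →L[ℂ] E) (u v : E) :
    ⟪v, ampliationCP W x u⟫_ℂ = ∫ a, ⟪W v a, x (W u a)⟫_ℂ ∂μ := by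
  rw [inner_ampliationCP, L2.inner_def]
  refine integral_congr_ae ?_
  filter_upwards [coeFn_compLpL (p := 2) x (W u)] with a h
  rw [h]

theorem ampliationCP_one_le {W : E →L[ℂ] Lp E 2 μ} (hW : ∀ u, ‖W u‖ ≤ ‖u‖) :
    ampliationCP W 1 ≤ 1 := by
  have h1 : (1 : E →L[ℂ] E).compLpL 2 μ = 1 := by
    refine ContinuousLinearMap.ext fun φ => Lp.ext ?_
    filter_upwards [coeFn_compLpL (p := 2) (1 : E →L[ℂ] E) φ] with a h
    rw [h]; rfl
  rw [ContinuousLinearMap.le_def]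
  refine ContinuousLinearMap.isPositive_iff_complex _ |>.2 fun u => ?_
  have h2 : ⟪(1 - ampliationCP W 1) u, u⟫_ℂ = ((‖u‖ ^ 2 - ‖W u‖ ^ 2 : ℝ) : ℂ) := by
    have h3 : (1 - ampliationCP W 1) u = u - ampliationCP W 1 u := rfl
    rw [h3, inner_sub_left, ← inner_conj_symm (ampliationCP W 1 u), inner_ampliationCP, h1]
    rw [one_apply_eq_self, inner_conj_symm, inner_self_eq_norm_sq_to_K, inner_self_eq_norm_sq_to_K]
    push_cast
    rfl
  rw [h2]
  refine ⟨rfl, ?_⟩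
  change 0 ≤ ‖u‖ ^ 2 - ‖W u‖ ^ 2
  rw [sub_nonneg]
  exact pow_le_pow_left₀ (norm_nonneg _) (hW u) 2


/-- The isometry `x ↦ η ⊗ x` for a unit vector `η`. -/
def tensorLeftₗᵢ (η : Lp ℂ 2 μ) (hη : ‖η‖ = 1) : E →ₗᵢ[ℂ] Lp E 2 μ where
  toLinearMap := (tensorLeft η).toLinearMap
  norm_map' x := by
    rw [← sq_eq_sq₀ (norm_nonneg _) (norm_nonneg _)]
    have h := inner_tensorLeft η η x x
    rw [inner_self_eq_norm_sq_to_K, inner_self_eq_norm_sq_to_K, inner_self_eq_norm_sq_to_K, hη] at h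
    have h1 : ((‖tensorLeft η x‖ ^ 2 : ℝ) : ℂ) = ((‖x‖ ^ 2 : ℝ) : ℂ) := by
      push_cast
      simpa using h
    exact_mod_cast h1

variable (E) in
-- The copies `b_i ⊗ E` are mutually orthogonal. Their closed span contains `η ⊗ x` for every `η` by
-- density of the span of `b`, hence all vector-valued indicators, hence all of `L²(μ; E)`.
theorem isHilbertSum_tensorLeft {ι : Type*} (b : HilbertBasis ι ℂ (Lp ℂ 2 μ)) :
    IsHilbertSum ℂ (fun _ : ι => E) (E := Lp E 2 μ)
      fun i => tensorLeftₗᵢ (b i) (b.orthonormal.1 i) := by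
  classical
  refine IsHilbertSum.mk (fun i j hij x y => ?_) ?_
  · change ⟪tensorLeft (b i) x, tensorLeft (b j) y⟫_ℂ = 0
    rw [inner_tensorLeft, b.orthonormal.2 hij, zero_mul]
  · set S := (⨆ i, (LinearMap.range
      (tensorLeftₗᵢ (E := E) (b i) (b.orthonormal.1 i)).toLinearMap)).topologicalClosure with hS
    have hclosed : IsClosed (S : Set (Lp E 2 μ)) := Submodule.isClosed_topologicalClosure _
    have h1 : ∀ (η : Lp ℂ 2 μ) (x : E), tensorLeft η x ∈ S := by
      intro η x
      let F : Lp ℂ 2 μ →L[ℂ] Lp E 2 μ :=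
        compLpL₂ 2 μ (ContinuousLinearMap.lsmul ℂ ℂ).flip x
      have h2 : (Submodule.span ℂ (Set.range b)).topologicalClosure ≤ S.comap F.toLinearMap := by
        refine Submodule.topologicalClosure_minimal _ (Submodule.span_le.2 ?_)
          (hclosed.preimage F.continuous)
        rintro _ ⟨i, rfl⟩
        exact Submodule.le_topologicalClosure _ (Submodule.mem_iSup_of_mem i ⟨x, rfl⟩)
      rw [b.dense_span] at h2
      exact h2 (Submodule.mem_top (x := η))
    rintro φ -
    refine Lp.induction ENNReal.ofNat_ne_top (motive := fun φ => φ ∈ S) ?_ ?_ hclosed φ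
    · intro c s hs hμs
      rw [Lp.simpleFunc.coe_indicatorConst, ← tensorLeft_indicatorConstLp]
      exact h1 _ _
    · intro f g hf hg _ h1 h2
      exact S.add_mem h1 h2

/-- Parseval's identity for the unitary `L²(μ; E) ≃ ℓ²(ι; E)` whose coordinates are the slices along
`b`. -/
theorem hasSum_inner_adjoint_tensorLeft {ι : Type*} (b : HilbertBasis ι ℂ (Lp ℂ 2 μ))
    (φ ψ : Lp E 2 μ) :
    HasSum (fun i => ⟪adjoint (tensorLeft (b i)) φ, adjoint (tensorLeft (b i)) ψ⟫_ℂ) ⟪φ, ψ⟫_ℂ := by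
  classical
  have hV := isHilbertSum_tensorLeft E b
  let e := hV.linearIsometryEquiv
  have h1 : ∀ (φ : Lp E 2 μ) i, e φ i = adjoint (tensorLeft (b i)) φ := by
    intro φ i
    refine ext_inner_left ℂ fun x : E => ?_
    have h3 : ⟪lp.single 2 i x, e φ⟫_ℂ = ⟪x, e φ i⟫_ℂ := lp.inner_single_left i x (e φ)
    have h4 : e.symm (lp.single 2 i x) = tensorLeft (b i) x :=
      hV.linearIsometryEquiv_symm_apply_single x
    rw [adjoint_inner_right, ← h4]
    refine h3.symm.trans ?_
    rw [← e.symm.inner_map_map, e.symm_apply_apply]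
  have h2 := lp.hasSum_inner (𝕜 := ℂ) (G := fun _ : ι => E) (e φ) (e ψ)
  rw [e.inner_map_map] at h2
  exact (funext fun i => congrArg₂ (inner ℂ) (h1 φ i) (h1 ψ i)) ▸ h2

variable (μ) in
/-- A Hilbert basis of `L²(μ)`. -/
def scalarBasis : HilbertBasis (exists_hilbertBasis ℂ (Lp ℂ 2 μ)).choose ℂ (Lp ℂ 2 μ) :=
  (exists_hilbertBasis ℂ (Lp ℂ 2 μ)).choose_spec.choose

/-- The components of `W : E → L²(μ; E)` with respect to a Hilbert basis of `L²(μ)`. -/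
def component (W : E →L[ℂ] Lp E 2 μ) (i : (exists_hilbertBasis ℂ (Lp ℂ 2 μ)).choose) :
    E →L[ℂ] E :=
  adjoint (tensorLeft (scalarBasis μ i)) ∘L W

theorem component_apply (W : E →L[ℂ] Lp E 2 μ)
    (i : (exists_hilbertBasis ℂ (Lp ℂ 2 μ)).choose) (u : E) :
    component W i u = adjoint (tensorLeft (scalarBasis μ i)) (W u) := rfl

theorem isKrausFamily_component {W : E →L[ℂ] Lp E 2 μ} (hW : ∀ u, ‖W u‖ ≤ ‖u‖) :
    IsKrausFamily (component W) := by
  intro u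
  have h := (hasSum_inner_adjoint_tensorLeft (scalarBasis μ) (W u) (W u)).mapL Complex.reCLM
  have h1 : HasSum (fun i => ‖component W i u‖ ^ 2) (‖W u‖ ^ 2) := by
    convert h using 1
    · ext i
      exact (inner_self_eq_norm_sq (𝕜 := ℂ) _).symm
    · exact (inner_self_eq_norm_sq (𝕜 := ℂ) _).symm
  refine ⟨h1.summable, h1.tsum_eq.le.trans ?_⟩
  exact pow_le_pow_left₀ (norm_nonneg _) (hW u) 2

/-- The adjoint of the pointwise identity `η ⊗ x^* y = (1 ⊗ x^*)(η ⊗ y)`: slicing intertwines `1 ⊗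
x` with `x`. -/
theorem apply_adjoint_tensorLeft (η : Lp ℂ 2 μ) (x : E →L[ℂ] E) (ψ : Lp E 2 μ) :
    x (adjoint (tensorLeft η) ψ) = adjoint (tensorLeft η) (x.compLpL 2 μ ψ) := by
  have h : tensorLeft η ∘L adjoint x = (adjoint x).compLpL 2 μ ∘L tensorLeft η := by
    refine ContinuousLinearMap.ext fun y => Lp.ext ?_
    filter_upwards [coeFn_compLpL (p := 2) (adjoint x) (tensorLeft η y),
      coeFn_tensorLeft η y, coeFn_tensorLeft η (adjoint x y)] with a h1 h2 h3
    rw [ContinuousLinearMap.comp_apply, ContinuousLinearMap.comp_apply, h1, h2, h3, map_smul]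
  have h' := congrArg adjoint h
  rw [adjoint_comp, adjoint_comp, adjoint_adjoint, adjoint_compLpL, adjoint_adjoint] at h'
  exact congrArg (fun L => L ψ) h'

/-- The Kraus decomposition of `W^* (1 ⊗ x) W`, in the weak form that `IsKrausFamily.trace_map_comp`
consumes. -/
theorem hasSum_inner_component (W : E →L[ℂ] Lp E 2 μ) (x : E →L[ℂ] E) (u v : E) :
    HasSum (fun i => ⟪component W i v, x (component W i u)⟫_ℂ) ⟪v, ampliationCP W x u⟫_ℂ := by
  rw [inner_ampliationCP]
  simp only [component_apply, apply_adjoint_tensorLeft]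
  exact hasSum_inner_adjoint_tensorLeft (scalarBasis μ) (W v) (x.compLpL 2 μ (W u))

end VectorL2

/-! ### Restriction to Borel sets and σ-additivity -/

section RestrictedMeasure

variable {α : Type*} [MeasurableSpace α] {μ : Measure α}
  {E : Type*} [NormedAddCommGroup E] [InnerProductSpace ℂ E]

theorem integral_norm_inner_le (φ ψ : Lp E 2 μ) :
    ∫ a, ‖⟪φ a, ψ a⟫_ℂ‖ ∂μ ≤ ‖φ‖ * ‖ψ‖ := by
  have h := eLpNorm_le_eLpNorm_mul_eLpNorm_of_nnnorm (p := 2) (q := 2) (r := 1)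
    (Lp.aestronglyMeasurable φ) (Lp.aestronglyMeasurable ψ) (fun x y => ⟪x, y⟫_ℂ) 1
    (Filter.Eventually.of_forall fun a => by
      rw [one_mul]
      exact nnnorm_inner_le_nnnorm _ _)
  rw [integral_norm_eq_lintegral_enorm
    ((Lp.aestronglyMeasurable φ).inner (Lp.aestronglyMeasurable ψ)), ← eLpNorm_one_eq_lintegral_enorm,
    Lp.norm_def, Lp.norm_def, ← ENNReal.toReal_mul]
  refine ENNReal.toReal_mono (ENNReal.mul_ne_top (Lp.eLpNorm_ne_top φ) (Lp.eLpNorm_ne_top ψ)) ?_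
  simpa using h

/-- An operator `V : E → L²(μ; E)` followed by the restriction to `B`. -/
def restrictOp (V : E →L[ℂ] Lp E 2 μ) (B : Set α) : E →L[ℂ] Lp E 2 (μ.restrict B) :=
  LpToLpRestrictCLM α E ℂ μ 2 B ∘L V

theorem coeFn_restrictOp (V : E →L[ℂ] Lp E 2 μ) (B : Set α) (u : E) :
    restrictOp V B u =ᵐ[μ.restrict B] V u :=
  LpToLpRestrictCLM_coeFn ℂ B (V u)

theorem norm_restrictOp_le {V : E →L[ℂ] Lp E 2 μ} (hV : ∀ u, ‖V u‖ ≤ ‖u‖) (B : Set α) (u : E) :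
    ‖restrictOp V B u‖ ≤ ‖u‖ :=
  (norm_Lp_toLp_restrict_le B (V u)).trans (hV u)

variable [CompleteSpace E]

theorem inner_ampliationCP_restrictOp (V : E →L[ℂ] Lp E 2 μ) (B : Set α) (x : E →L[ℂ] E)
    (u v : E) :
    ⟪v, ampliationCP (restrictOp V B) x u⟫_ℂ = ∫ a in B, ⟪V v a, x (V u a)⟫_ℂ ∂μ := by
  rw [inner_ampliationCP_eq_integral]
  refine integral_congr_ae ?_
  filter_upwards [coeFn_restrictOp V B u, coeFn_restrictOp V B v] with a h1 h2
  rw [h1, h2]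

/-- Each term `|u i⟩⟨v i|` of `ρ` contributes the density `⟪V (v i) a, x (V (u i) a)⟫`, with `L¹`
norm at most `‖V‖² ‖x‖ ‖u i‖ ‖v i‖`. The densities therefore sum in `L¹`, and integration over `B`
is continuous there. -/
theorem exists_complexMeasure_trace_ampliationCP (V : E →L[ℂ] Lp E 2 μ) (ρ : nuclear E)
    (x : E →L[ℂ] E) : ∃ ν : ComplexMeasure α, ∀ B, MeasurableSet B →
      ν B = trace ((ρ : E →L[ℂ] E) ∘L ampliationCP (restrictOp V B) x) := by
  obtain ⟨u, v, h⟩ := ρ.2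
  have hae : ∀ i, (fun a => ⟪V (v i) a, x.compLpL 2 μ (V (u i)) a⟫_ℂ) =ᵐ[μ]
      fun a => ⟪V (v i) a, x (V (u i) a)⟫_ℂ := fun i => by
    filter_upwards [coeFn_compLpL (p := 2) x (V (u i))] with a h
    rw [h]
  have hint : ∀ i, Integrable (fun a => ⟪V (v i) a, x (V (u i) a)⟫_ℂ) μ := fun i =>
    (L2.integrable_inner (𝕜 := ℂ) (V (v i)) (x.compLpL 2 μ (V (u i)))).congr (hae i)
  have hnorm : ∀ i, ‖(hint i).toL1‖ ≤ (‖V‖ * ‖x‖ * ‖V‖) * (‖u i‖ * ‖v i‖) := by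
    intro i
    rw [L1.norm_eq_integral_norm, integral_congr_ae (((hint i).coeFn_toL1.trans (hae i).symm).mono
      fun a ha => congrArg norm ha)]
    refine (integral_norm_inner_le _ _).trans ?_
    calc ‖V (v i)‖ * ‖x.compLpL 2 μ (V (u i))‖ ≤ (‖V‖ * ‖v i‖) * (‖x‖ * (‖V‖ * ‖u i‖)) := by
          gcongr
          · exact V.le_opNorm _
          · exact (x.norm_compLp_le _).trans (by gcongr; exact V.le_opNorm _)
      _ = _ := by ring
  have hsum : Summable fun i => (hint i).toL1 := .of_norm_bounded (h.1.mul_left _) hnorm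
  refine ⟨μ.withDensityᵥ (∑' i, (hint i).toL1 : Lp ℂ 1 μ), fun B hB => ?_⟩
  rw [withDensityᵥ_apply (L1.integrable_coeFn _) hB, h.isRankOneSum.trace_comp]
  let g : Lp ℂ 1 μ →+ ℂ := AddMonoidHom.mk' (fun f => ∫ a in B, f a ∂μ) fun f g => by
    rw [← integral_add (L1.integrable_coeFn f).integrableOn (L1.integrable_coeFn g).integrableOn]
    exact integral_congr_ae (ae_restrict_of_ae (Lp.coeFn_add f g))
  have h1 := hsum.hasSum.map g (continuous_setIntegral B)
  refine h1.tsum_eq.symm.trans (tsum_congr fun i => ?_)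
  rw [inner_ampliationCP_restrictOp]
  exact integral_congr_ae (ae_restrict_of_ae (hint i).coeFn_toL1)

end RestrictedMeasure

/-! ### Inner products of Slater determinants -/

theorem lebesgue_inner_eq_integral (f g : OneParticle) :
    ⟪f, g⟫_ℂ = ∫ x, conj (f x) * g x ∂lebesgue := by
  rw [L2.inner_def]
  simp [mul_comm]

theorem integrable_conj_mul (f g : OneParticle) :
    Integrable (fun x => conj (f x) * g x) lebesgue := by
  simpa [mul_comm] using L2.integrable_inner (𝕜 := ℂ) f g

/-- Expanding both Slater determinants and applying Fubini gives a sum over pairs `(σ, τ)`. For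
fixed `σ` the sum over `τ` is already the Gram determinant, and the `n!` choices of `σ` cancel the
normalisation. -/
theorem inner_wedgeLp {n : ℕ} (f g : Fin n → OneParticle) :
    ⟪wedgeLp f, wedgeLp g⟫_ℂ = (Matrix.of fun i j => ⟪f i, g j⟫_ℂ).det := by
  have h1 : ⟪wedgeLp f, wedgeLp g⟫_ℂ = ∫ x, conj (slater f x) * slater g x ∂lebesguePi n := by
    rw [L2.inner_def]
    refine integral_congr_ae ?_
    filter_upwards [MemLp.coeFn_toLp (memLp_slater f), MemLp.coeFn_toLp (memLp_slater g)] with x h h'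
    rw [wedgeLp, wedgeLp, h, h']
    simp [mul_comm]
  have h2 : ∀ x, conj (slater f x) * slater g x = ((n.factorial : ℂ))⁻¹ *
      ∑ σ : Equiv.Perm (Fin n), ∑ τ : Equiv.Perm (Fin n),
        (((Equiv.Perm.sign σ : ℤ) : ℂ) * ((Equiv.Perm.sign τ : ℤ) : ℂ)) *
          ∏ i, (conj (f (σ.symm i) (x i)) * g (τ.symm i) (x i)) := by
    intro x
    have hdet : ∀ f : Fin n → OneParticle, (Matrix.of fun i j => f j (x i)).det =
        ∑ σ : Equiv.Perm (Fin n), ((Equiv.Perm.sign σ : ℤ) : ℂ) * ∏ i, f (σ.symm i) (x i) := by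
      intro f
      rw [Matrix.det_apply']
      refine Finset.sum_congr rfl fun σ _ => ?_
      congr 1
      exact Fintype.prod_equiv σ _ _ fun i => by simp
    have hsq : ((Real.sqrt (n.factorial : ℝ) : ℂ))⁻¹ * ((Real.sqrt (n.factorial : ℝ) : ℂ))⁻¹ =
        ((n.factorial : ℂ))⁻¹ := by
      rw [← mul_inv, ← Complex.ofReal_mul, Real.mul_self_sqrt (by positivity)]
      simp
    rw [slater, slater, hdet, hdet, ← hsq]
    simp only [map_mul, map_inv₀, Complex.conj_ofReal, map_sum, map_prod, map_intCast,
      Finset.prod_mul_distrib]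
    rw [mul_mul_mul_comm, Finset.sum_mul_sum]
    congr 1
    refine Finset.sum_congr rfl fun σ _ => Finset.sum_congr rfl fun τ _ => ?_
    ring
  have h3 : ∀ σ τ : Equiv.Perm (Fin n), Integrable (fun x : Fin n → ℝ≥0 =>
      ∏ i, (conj (f (σ.symm i) (x i)) * g (τ.symm i) (x i))) (lebesguePi n) := fun σ τ =>
    Integrable.fintype_prod (f := fun i y => conj (f (σ.symm i) y) * g (τ.symm i) y)
      fun i => integrable_conj_mul _ _
  have h4 : ∀ σ τ : Equiv.Perm (Fin n), ∫ x : Fin n → ℝ≥0,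
      ∏ i, (conj (f (σ.symm i) (x i)) * g (τ.symm i) (x i)) ∂(lebesguePi n) =
      ∏ i, ⟪f (σ.symm i), g (τ.symm i)⟫_ℂ := by
    intro σ τ
    simp only [lebesgue_inner_eq_integral]
    exact integral_fintype_prod_eq_prod (fun i y => conj (f (σ.symm i) y) * g (τ.symm i) y)
  have h5 : ∀ σ : Equiv.Perm (Fin n), ∑ τ : Equiv.Perm (Fin n),
      (((Equiv.Perm.sign σ : ℤ) : ℂ) * ((Equiv.Perm.sign τ : ℤ) : ℂ)) *
          ∏ i, ⟪f (σ.symm i), g (τ.symm i)⟫_ℂ = (Matrix.of fun i j => ⟪f i, g j⟫_ℂ).det := by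
    intro σ
    rw [← Matrix.det_transpose, Matrix.det_apply']
    -- The product depends on the pair only through the relative permutation `τ⁻¹ σ`.
    refine Fintype.sum_equiv ((Equiv.inv _).trans (Equiv.mulRight σ)) _ _ fun τ => ?_
    simp only [Equiv.trans_apply, Equiv.inv_apply, Equiv.coe_mulRight, Equiv.Perm.sign_mul,
      Equiv.Perm.sign_inv]
    congr 1
    · push_cast
      ring
    · exact Fintype.prod_equiv σ.symm _ _ fun i => by simp [Equiv.Perm.inv_def]
  rw [h1]
  simp_rw [h2]
  rw [integral_const_mul, integral_finsetSum _ fun σ _ => integrable_finsetSum _ fun τ _ =>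
    (h3 σ τ).const_mul _]
  simp_rw [fun σ : Equiv.Perm (Fin n) => integral_finsetSum Finset.univ
    fun τ _ => (h3 σ τ).const_mul
      (((Equiv.Perm.sign σ : ℤ) : ℂ) * ((Equiv.Perm.sign τ : ℤ) : ℂ)), integral_const_mul, h4, h5]
  rw [Finset.sum_const, Finset.card_univ, Fintype.card_perm, Fintype.card_fin, nsmul_eq_mul,
    inv_mul_cancel_left₀ (by exact_mod_cast n.factorial_ne_zero)]

/-! ### The vectors `f₁ ∧ … ∧ fₙ` of the Fock space -/

theorem inner_wedge_left {n : ℕ} (f : Fin n → OneParticle) (F : lp (fun n : ℕ => nParticle n) 2) :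
    ⟪wedge f, (F : Fock)⟫_ℂ = ⟪wedgeN f, F n⟫_ℂ :=
  lp.inner_single_left (𝕜 := ℂ) (G := fun n : ℕ => nParticle n) n (wedgeN f) F

theorem inner_wedge_wedge {n : ℕ} (f g : Fin n → OneParticle) :
    ⟪wedge f, wedge g⟫_ℂ = (Matrix.of fun i j => ⟪f i, g j⟫_ℂ).det := by
  have h : (lp.single 2 n (wedgeN g) : lp (fun n : ℕ => nParticle n) 2) n = wedgeN g :=
    lp.single_apply_self (E := fun n : ℕ => nParticle n) 2 n (wedgeN g)
  exact (inner_wedge_left f _).trans ((congrArg (inner ℂ (wedgeN f)) h).trans (inner_wedgeLp f g))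

theorem inner_wedge_wedge_of_ne {m n : ℕ} (h : m ≠ n) (f : Fin m → OneParticle)
    (g : Fin n → OneParticle) : ⟪wedge f, wedge g⟫_ℂ = 0 := by
  have h' : (lp.single 2 n (wedgeN g) : lp (fun n : ℕ => nParticle n) 2) m = 0 :=
    lp.single_apply_ne (E := fun n : ℕ => nParticle n) 2 n (wedgeN g) h
  exact (inner_wedge_left f _).trans ((congrArg (inner ℂ (wedgeN f)) h').trans (inner_zero_right _))

/-- All vectors `f₁ ∧ … ∧ fₙ`, as a single family. -/
def wedgeFamily (f : Σ n : ℕ, Fin n → OneParticle) : Fock := wedge f.2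

theorem topologicalClosure_span_wedge :
    (Submodule.span ℂ (Set.range wedgeFamily)).topologicalClosure = ⊤ := by
  set S := (Submodule.span ℂ (Set.range wedgeFamily)).topologicalClosure with hS
  have hclosed : IsClosed (S : Set Fock) := Submodule.isClosed_topologicalClosure _
  have h1 : ∀ (n : ℕ) (x : nParticle n),
      ((lp.single 2 n x : lp (fun n : ℕ => nParticle n) 2) : Fock) ∈ S := by
    intro n x
    let T : nParticle n →L[ℂ] Fock :=
      (lp.singleContinuousLinearMap ℂ (fun n : ℕ => nParticle n) 2 n :
        nParticle n →L[ℂ] lp (fun n : ℕ => nParticle n) 2)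
    -- The claim is moved into `L²(ℝ₊ⁿ)`, where `nParticle n` is the least closed subspace
    -- containing the vectors `wedgeLp f`.
    let P : Submodule ℂ (Lp ℂ 2 (lebesguePi n)) :=
      (S.comap T.toLinearMap).map (nParticle n).subtype
    have hP : IsClosed (P : Set (Lp ℂ 2 (lebesguePi n))) :=
      (Submodule.isClosed_topologicalClosure _).isClosedEmbedding_subtypeVal.isClosedMap _
        (hclosed.preimage T.continuous)
    have hle : nParticle n ≤ P := by
      refine Submodule.topologicalClosure_minimal _ (Submodule.span_le.2 ?_) hP
      rintro _ ⟨f, rfl⟩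
      exact ⟨wedgeN f, Submodule.le_topologicalClosure _ (Submodule.subset_span ⟨⟨n, f⟩, rfl⟩), rfl⟩
    obtain ⟨y, hy, hyx⟩ := hle x.2
    obtain rfl : y = x := Subtype.ext hyx
    exact hy
  refine eq_top_iff.2 fun F _ => ?_
  have h2 := lp.hasSum_single (E := fun n : ℕ => nParticle n) (p := 2) ENNReal.ofNat_ne_top F
  exact hclosed.mem_of_tendsto h2 (Filter.Eventually.of_forall fun s => S.sum_mem fun i _ => h1 i _)

theorem ext_inner_wedge {x y : Fock} (h : ∀ (n : ℕ) (g : Fin n → OneParticle),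
    ⟪x, wedge g⟫_ℂ = ⟪y, wedge g⟫_ℂ) : x = y := by
  have hdense : Dense (Submodule.span ℂ (Set.range wedgeFamily) : Set Fock) := by
    rw [Submodule.dense_iff_topologicalClosure_eq_top]
    exact topologicalClosure_span_wedge
  have h1 : innerSL ℂ x = innerSL ℂ y := ContinuousLinearMap.ext_on hdense (by
    rintro _ ⟨⟨n, g⟩, rfl⟩
    exact h n g)
  exact ext_inner_right ℂ fun v => congrArg (fun L => L v) h1

/-- Tested against wedge vectors, both sides are Gram determinants, and the adjoint moves across in
each entry separately. -/
theorem adjoint_fockShift_wedge (t : ℝ≥0) {n : ℕ} (f : Fin n → OneParticle) :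
    adjoint (fockShift t) (wedge f) =
      wedge fun j => adjoint (shift t).toContinuousLinearMap (f j) := by
  refine ext_inner_wedge fun m g => ?_
  rw [adjoint_inner_left, fockShift_wedge]
  by_cases h : n = m
  · subst h
    rw [inner_wedge_wedge, inner_wedge_wedge]
    simp only [adjoint_inner_left]
    rfl
  · rw [inner_wedge_wedge_of_ne h, inner_wedge_wedge_of_ne h]

/-! ### The left shift -/

/-- The left shift `(S_t^* f)(x) = f(x + t)`. -/
def shiftAdj (t : ℝ≥0) : OneParticle →L[ℂ] OneParticle :=
  adjoint (shift t).toContinuousLinearMap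

theorem measurePreserving_add (t : ℝ≥0) :
    MeasurePreserving (fun x : ℝ≥0 => x + t) lebesgue (lebesgue.restrict (Set.Ici t)) := by
  have hm : Measurable fun x : ℝ≥0 => x + t := measurable_id.add_const t
  refine ⟨hm, ?_⟩
  have h : Measure.map (fun x => x + t) lebesgue =
      Measure.map ((fun x => x + t) ∘ fun x => x - t) (lebesgue.restrict (Set.Ici t)) := by
    rw [← Measure.map_map hm (measurable_sub t), (measurePreserving_sub t).map_eq]
  rw [h]
  refine (Measure.map_congr ?_).trans Measure.map_id
  filter_upwards [ae_restrict_mem measurableSet_Ici] with x hx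
  exact tsub_add_cancel_of_le hx

theorem setIntegral_add (t : ℝ≥0) {F : Type*} [NormedAddCommGroup F] [NormedSpace ℝ F]
    (h : ℝ≥0 → F) (B : Set ℝ≥0) :
    ∫ r in B, h (r + t) ∂lebesgue = ∫ r in (fun r => r + t) '' B, h r ∂lebesgue := by
  have he : MeasurableEmbedding fun x : ℝ≥0 => x + t :=
    (continuous_add_const t).measurableEmbedding (add_left_injective t)
  refine (((measurePreserving_add t).restrict_image_emb he B).integral_comp he h).trans ?_
  rw [Measure.restrict_restrict_of_subset]
  rintro _ ⟨x, _, rfl⟩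
  exact le_add_self (a := t) (b := x)

theorem ae_add {p : ℝ≥0 → Prop} (h : ∀ᵐ x ∂lebesgue, p x) (t : ℝ≥0) :
    ∀ᵐ x ∂lebesgue, p (x + t) :=
  (measurePreserving_add t).quasiMeasurePreserving.ae (ae_restrict_of_ae h)

theorem coeFn_shift (t : ℝ≥0) (f : OneParticle) :
    shift t f =ᵐ[lebesgue] (Set.Ici t).indicator (f ∘ fun y => y - t) :=
  MemLp.coeFn_toLp (memLp_pullback measurableSet_Ici (measurePreserving_sub t) f)

theorem coeFn_shiftAdj (t : ℝ≥0) (f : OneParticle) :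
    shiftAdj t f =ᵐ[lebesgue] fun x => f (x + t) := by
  have hF : MemLp (fun x => f (x + t)) 2 lebesgue :=
    ((Lp.memLp f).restrict (Set.Ici t)).comp_measurePreserving (measurePreserving_add t)
  have h : shiftAdj t f = hF.toLp _ := by
    refine ext_inner_left ℂ fun g => ?_
    rw [shiftAdj, adjoint_inner_right, lebesgue_inner_eq_integral, lebesgue_inner_eq_integral]
    have h1 : ∫ x, conj (shift t g x) * f x ∂lebesgue =
        ∫ x in (fun x => x + t) '' Set.univ, conj (g (x - t)) * f x ∂lebesgue := by
      have himg : (fun x => x + t) '' Set.univ = Set.Ici t := by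
        ext x
        simp only [Set.image_univ, Set.mem_range, Set.mem_Ici]
        exact ⟨by rintro ⟨y, rfl⟩; exact le_add_self, fun hx => ⟨x - t, tsub_add_cancel_of_le hx⟩⟩
      rw [himg, ← integral_indicator measurableSet_Ici]
      refine integral_congr_ae ?_
      filter_upwards [coeFn_shift t g] with x hx
      rw [hx]
      by_cases hxt : x ∈ Set.Ici t <;> simp [hxt]
    refine h1.trans ?_
    rw [← setIntegral_add, setIntegral_univ]
    refine integral_congr_ae ?_
    filter_upwards [hF.coeFn_toLp] with x hx
    rw [hx, add_tsub_cancel_right]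
  rw [h]
  exact hF.coeFn_toLp

/-- The source of the tail integrals: moving `[t, ∞)` onto `ℝ₊` loses exactly the part of the
integral over `[0, t)`. -/
theorem inner_shiftAdj (t : ℝ≥0) (f g : OneParticle) :
    ⟪shiftAdj t f, shiftAdj t g⟫_ℂ = ∫ x in Set.Ici t, conj (f x) * g x ∂lebesgue := by
  rw [lebesgue_inner_eq_integral]
  have h1 : ∫ x, conj (shiftAdj t f x) * shiftAdj t g x ∂lebesgue =
      ∫ x, conj (f (x + t)) * g (x + t) ∂lebesgue := by
    refine integral_congr_ae ?_
    filter_upwards [coeFn_shiftAdj t f, coeFn_shiftAdj t g] with x h h'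
    rw [h, h']
  rw [h1]
  have he : MeasurableEmbedding fun x : ℝ≥0 => x + t :=
    (continuous_add_const t).measurableEmbedding (add_left_injective t)
  exact (measurePreserving_add t).integral_comp he (fun x => conj (f x) * g x)

theorem shiftAdj_shiftAdj (s t : ℝ≥0) (f : OneParticle) :
    shiftAdj s (shiftAdj t f) = shiftAdj (s + t) f := by
  refine Lp.ext ?_
  filter_upwards [coeFn_shiftAdj s (shiftAdj t f), ae_add (coeFn_shiftAdj t f) s,
    coeFn_shiftAdj (s + t) f] with x h1 h2 h3
  rw [h1, h2, h3, add_assoc]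

/-- Extend `f` by zero to the line, use strong continuity of translations on `L²(ℝ)`, and restrict
back to the half-line. -/
theorem continuous_shiftAdj (f : OneParticle) : Continuous fun t : ℝ≥0 => shiftAdj t f := by
  have hcoe : MeasurePreserving ((↑) : ℝ≥0 → ℝ) lebesgue (volume.restrict (Set.Ici 0)) := by
    refine ⟨measurableEmbedding_coe.measurable, ?_⟩
    rw [lebesgue, measurableEmbedding_coe.map_comap]
    congr 1
    ext x
    simp
  have hnn : MeasurePreserving Real.toNNReal (volume.restrict (Set.Ici 0)) lebesgue := by
    refine ⟨measurable_real_toNNReal, ?_⟩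
    rw [← hcoe.map_eq, Measure.map_map measurable_real_toNNReal measurableEmbedding_coe.measurable]
    simp [Function.comp_def]
  have hF : MemLp ((Set.Ici (0 : ℝ)).indicator fun x => f x.toNNReal) 2 volume :=
    (memLp_indicator_iff_restrict measurableSet_Ici).2
      ((Lp.memLp f).comp_measurePreserving hnn)
  have htr : ∀ t : ℝ≥0, MeasurePreserving (fun x : ℝ => x + t) volume volume := fun t =>
    measurePreserving_add_right volume (t : ℝ)
  let g : ℝ≥0 → C(ℝ, ℝ) := fun t => ⟨fun x => x + t, by fun_prop⟩
  have hg : Continuous g := ContinuousMap.continuous_of_continuous_uncurry _ (by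
    simp only [g, Function.uncurry_def, ContinuousMap.coe_mk]
    fun_prop)
  have h1 : Continuous fun t : ℝ≥0 => Lp.compMeasurePreserving (g t) (htr t) (hF.toLp _) :=
    continuous_const.compMeasurePreservingLp hg htr ENNReal.ofNat_ne_top
  have h2 : Continuous fun F : Lp ℂ 2 (volume : Measure ℝ) =>
      Lp.compMeasurePreserving _ hcoe (LpToLpRestrictCLM ℝ ℂ ℂ volume 2 (Set.Ici 0) F) :=
    (Lp.isometry_compMeasurePreserving hcoe).continuous.comp (LpToLpRestrictCLM _ _ _ _ _ _).continuous
  refine (h2.comp h1).congr fun t => Lp.ext ?_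
  have h3 : ∀ᵐ x : ℝ, Lp.compMeasurePreserving (g t) (htr t) (hF.toLp _) x =
      (Set.Ici (0 : ℝ)).indicator (fun x => f x.toNNReal) (x + t) := by
    filter_upwards [Lp.coeFn_compMeasurePreserving (hF.toLp _) (htr t),
      (htr t).quasiMeasurePreserving.ae hF.coeFn_toLp] with x h h'
    rw [← h']
    exact h
  have h4 : ∀ᵐ x : ℝ≥0 ∂lebesgue, Lp.compMeasurePreserving (g t) (htr t) (hF.toLp _) (x : ℝ) =
      (Set.Ici (0 : ℝ)).indicator (fun x => f x.toNNReal) (x + t) :=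
    hcoe.quasiMeasurePreserving.ae (ae_restrict_of_ae h3)
  filter_upwards [coeFn_shiftAdj t f, h4, Lp.coeFn_compMeasurePreserving
    (LpToLpRestrictCLM ℝ ℂ ℂ volume 2 (Set.Ici 0)
      (Lp.compMeasurePreserving (g t) (htr t) (hF.toLp _))) hcoe,
    hcoe.quasiMeasurePreserving.ae (LpToLpRestrictCLM_coeFn ℂ (Set.Ici 0)
      (Lp.compMeasurePreserving (g t) (htr t) (hF.toLp _)))] with x k1 k2 k3 k4
  rw [k1]
  refine k3.trans (k4.trans (k2.trans ?_))
  have hx : (x : ℝ) + t ∈ Set.Ici (0 : ℝ) := by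
    simp only [Set.mem_Ici]
    positivity
  rw [Set.indicator_of_mem hx, ← NNReal.coe_add, Real.toNNReal_coe]

/-! ### Products of tail integrals -/

instance : NullSingletonClass lebesgue := ⟨fun x => by simp [lebesgue_apply]⟩

/-- The tail integral `∫_r^∞ h(x) dx`. -/
def tail (h : ℝ≥0 → ℂ) (r : ℝ≥0) : ℂ := ∫ x in Set.Ici r, h x ∂lebesgue

theorem integrable_mul_tail {h k : ℝ≥0 → ℂ} (hh : Integrable h lebesgue)
    (hk : Integrable k lebesgue) : Integrable (fun x => h x * tail k x) lebesgue := by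
  have hA : MeasurableSet {p : ℝ≥0 × ℝ≥0 | p.1 ≤ p.2} := measurableSet_le measurable_fst measurable_snd
  have h1 := ((hh.mul_prod hk).indicator hA).integral_prod_left
  refine h1.congr (Filter.Eventually.of_forall fun x => ?_)
  simp only [tail]
  rw [← integral_const_mul, ← integral_indicator measurableSet_Ici]
  congr 1

/-- Fubini on the two sides of the diagonal of `ℝ₊²`, sorted by which variable is the smaller. -/
theorem integral_mul_integral_eq {h k : ℝ≥0 → ℂ} (hh : Integrable h lebesgue)
    (hk : Integrable k lebesgue) :
    (∫ x, h x ∂lebesgue) * ∫ x, k x ∂lebesgue =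
      ∫ x, (h x * tail k x + tail h x * k x) ∂lebesgue := by
  have hA : MeasurableSet {p : ℝ≥0 × ℝ≥0 | p.1 ≤ p.2} := measurableSet_le measurable_fst measurable_snd
  have hint := hh.mul_prod hk
  have hi : Integrable (fun x => tail h x * k x) lebesgue := by
    simpa only [mul_comm] using integrable_mul_tail hk hh
  rw [← integral_prod_mul, integral_add (integrable_mul_tail hh hk) hi,
    ← integral_add_compl hA hint]
  congr 1
  · rw [← integral_indicator hA, integral_prod _ (hint.indicator hA)]
    refine integral_congr_ae (Filter.Eventually.of_forall fun x => ?_)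
    simp only [tail]
    rw [← integral_const_mul, ← integral_indicator measurableSet_Ici]
    congr 1
  · rw [← integral_indicator hA.compl, integral_prod_symm _ (hint.indicator hA.compl)]
    refine integral_congr_ae (Filter.Eventually.of_forall fun x => ?_)
    simp only [tail]
    -- The region off `p.1 ≤ p.2` is strict, so its slices are open half-lines; points being null,
    -- this does not change the tail.
    rw [← integral_mul_const, integral_Ici_eq_integral_Ioi, ← integral_indicator measurableSet_Ioi]
    refine integral_congr_ae (Filter.Eventually.of_forall fun y => ?_)
    by_cases hxy : x < y
    · simp [Set.indicator, hxy]
    · simp [Set.indicator, hxy]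

theorem tail_indicator {h : ℝ≥0 → ℂ} {r x : ℝ≥0} (hx : r ≤ x) :
    tail ((Set.Ici r).indicator h) x = tail h x := by
  refine setIntegral_congr_fun measurableSet_Ici fun y hy => ?_
  exact Set.indicator_of_mem (show y ∈ Set.Ici r from hx.trans hy) h

theorem tail_mul_tail {h k : ℝ≥0 → ℂ} (hh : Integrable h lebesgue) (hk : Integrable k lebesgue)
    (r : ℝ≥0) : tail h r * tail k r = tail (fun x => h x * tail k x + tail h x * k x) r := by
  have h1 := integral_mul_integral_eq (hh.indicator (measurableSet_Ici (a := r)))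
    (hk.indicator (measurableSet_Ici (a := r)))
  rw [integral_indicator measurableSet_Ici, integral_indicator measurableSet_Ici] at h1
  refine h1.trans ?_
  rw [tail, ← integral_indicator measurableSet_Ici]
  refine integral_congr_ae (Filter.Eventually.of_forall fun x => ?_)
  by_cases hx : x ∈ Set.Ici r
  · simp only [Set.indicator_of_mem hx, tail_indicator (Set.mem_Ici.1 hx)]
  · simp only [Set.indicator_of_notMem hx, zero_mul, mul_zero, add_zero]

/-- The Leibniz rule in integrated form, needing no differentiability, by induction from
`tail_mul_tail`. It fails for the empty product, which is `1` while the right side is `0`; this is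
why the vacuum is treated apart. -/
theorem tail_prod {ι : Type*} [DecidableEq ι] {h : ι → ℝ≥0 → ℂ}
    (hh : ∀ i, Integrable (h i) lebesgue) {s : Finset ι} (hs : s.Nonempty) :
    Integrable (fun x => ∑ i ∈ s, h i x * ∏ j ∈ s.erase i, tail (h j) x) lebesgue ∧
      ∀ r, ∏ i ∈ s, tail (h i) r =
        tail (fun x => ∑ i ∈ s, h i x * ∏ j ∈ s.erase i, tail (h j) x) r := by
  induction hs using Finset.Nonempty.cons_induction with
  | singleton a => simpa using hh a
  | cons a s ha hs ih =>
    have key : (fun x => ∑ i ∈ Finset.cons a s ha, h i x *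
        ∏ j ∈ (Finset.cons a s ha).erase i, tail (h j) x) = fun x =>
        h a x * tail (fun x => ∑ i ∈ s, h i x * ∏ j ∈ s.erase i, tail (h j) x) x +
          tail (h a) x * ∑ i ∈ s, h i x * ∏ j ∈ s.erase i, tail (h j) x := by
      funext x
      rw [Finset.sum_cons, ← ih.2, Finset.mul_sum]
      congr 1
      · rw [Finset.erase_cons]
      · refine Finset.sum_congr rfl fun i hi => ?_
        have hia : a ≠ i := fun h => ha (h ▸ hi)
        rw [Finset.cons_eq_insert, Finset.erase_insert_of_ne hia, Finset.prod_insert (by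
          simp [ha])]
        ring
    rw [key]
    refine ⟨(integrable_mul_tail (hh a) ih.1).add ?_, fun r => ?_⟩
    · simpa only [mul_comm] using integrable_mul_tail ih.1 (hh a)
    · rw [Finset.prod_cons, ih.2, tail_mul_tail (hh a) ih.1]

/-- Both sides are the derivative of `det` at `T` in the direction `H`: replace one column of `T` by
that of `H`, sum over columns, and expand each determinant along the replaced column. -/
theorem det_deriv_expansion {n : ℕ} (H T : Matrix (Fin (n + 1)) (Fin (n + 1)) ℂ) :
    ∑ σ : Equiv.Perm (Fin (n + 1)), ((Equiv.Perm.sign σ : ℤ) : ℂ) *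
      ∑ i, H (σ i) i * ∏ l ∈ Finset.univ.erase i, T (σ l) l =
    ∑ j : Fin (n + 1), ∑ k : Fin (n + 1), (-1) ^ ((j : ℕ) + (k : ℕ)) *
      (H j k * (T.submatrix j.succAbove k.succAbove).det) := by
  have h1 : ∀ i, (T.updateCol i fun j => H j i).det =
      ∑ σ : Equiv.Perm (Fin (n + 1)), ((Equiv.Perm.sign σ : ℤ) : ℂ) *
        (H (σ i) i * ∏ l ∈ Finset.univ.erase i, T (σ l) l) := by
    intro i
    rw [Matrix.det_apply']
    refine Finset.sum_congr rfl fun σ _ => ?_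
    rw [← Finset.mul_prod_erase _ _ (Finset.mem_univ i), Matrix.updateCol_self]
    congr 2
    refine Finset.prod_congr rfl fun l hl => ?_
    rw [Matrix.updateCol_ne (Finset.ne_of_mem_erase hl)]
  simp_rw [Finset.mul_sum]
  refine Finset.sum_comm.trans (Eq.trans ?_ Finset.sum_comm)
  refine Finset.sum_congr rfl fun k _ => ?_
  rw [← h1, Matrix.det_succ_column _ k]
  refine Finset.sum_congr rfl fun j _ => ?_
  rw [Matrix.updateCol_self, mul_assoc]
  congr 3
  ext a b
  simp

/-- The fundamental theorem of calculus for the determinant of tail integrals: the integrand is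
formally minus its derivative, and at `0` the tails are the full integrals. -/
theorem integral_det_tail {n : ℕ} {h : Fin (n + 1) → Fin (n + 1) → ℝ≥0 → ℂ}
    (hh : ∀ i j, Integrable (h i j) lebesgue) :
    ∫ x, ∑ j : Fin (n + 1), ∑ k : Fin (n + 1), (-1) ^ ((j : ℕ) + (k : ℕ)) *
      (h j k x * (Matrix.of fun a b => tail (h (j.succAbove a) (k.succAbove b)) x).det) ∂lebesgue =
    (Matrix.of fun i j => ∫ x, h i j x ∂lebesgue).det := by
  have h0 : ∀ h : ℝ≥0 → ℂ, tail h 0 = ∫ x, h x ∂lebesgue := by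
    intro h
    have : Set.Ici (0 : ℝ≥0) = Set.univ := by ext x; simp
    rw [tail, this, setIntegral_univ]
  have h1 : ∀ x, ∑ j : Fin (n + 1), ∑ k : Fin (n + 1), (-1) ^ ((j : ℕ) + (k : ℕ)) *
      (h j k x * (Matrix.of fun a b => tail (h (j.succAbove a) (k.succAbove b)) x).det) =
      ∑ σ : Equiv.Perm (Fin (n + 1)), ((Equiv.Perm.sign σ : ℤ) : ℂ) *
        ∑ i, h (σ i) i x * ∏ l ∈ Finset.univ.erase i, tail (h (σ l) l) x := fun x =>
    (det_deriv_expansion (Matrix.of fun i j => h i j x) (Matrix.of fun i j => tail (h i j) x)).symm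
  simp_rw [h1]
  have h2 := fun σ : Equiv.Perm (Fin (n + 1)) =>
    tail_prod (h := fun i => h (σ i) i) (fun i => hh _ _) Finset.univ_nonempty
  rw [integral_finsetSum _ fun σ _ => (h2 σ).1.const_mul _, Matrix.det_apply']
  refine Finset.sum_congr rfl fun σ _ => ?_
  rw [integral_const_mul, ← h0, ← (h2 σ).2]
  simp only [h0, Matrix.of_apply]

/-! ### Gram matrices, contractions and operator-valued integrals -/

section HilbertSpace

variable {E F : Type*} [NormedAddCommGroup E] [InnerProductSpace ℂ E]
  [NormedAddCommGroup F] [InnerProductSpace ℂ F]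

/-- `‖w t - w r‖²` expands into four values of the Gram kernel, which cancel at `t = r`. -/
theorem continuous_of_continuous_inner {X : Type*} [TopologicalSpace X] {w : X → E}
    (h : Continuous fun p : X × X => ⟪w p.1, w p.2⟫_ℂ) : Continuous w := by
  refine continuous_iff_continuousAt.2 fun r => ?_
  rw [ContinuousAt, tendsto_iff_norm_sub_tendsto_zero]
  have h1 : ∀ t, ‖w t - w r‖ = Real.sqrt (⟪w t, w t⟫_ℂ - ⟪w t, w r⟫_ℂ - ⟪w r, w t⟫_ℂ + ⟪w r, w r⟫_ℂ).re := by
    intro t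
    have h2 := inner_sub_sub_self (𝕜 := ℂ) (w t) (w r)
    rw [← h2]
    exact norm_eq_sqrt_re_inner (𝕜 := ℂ) _
  have h2 : Continuous fun t => Real.sqrt
      (⟪w t, w t⟫_ℂ - ⟪w t, w r⟫_ℂ - ⟪w r, w t⟫_ℂ + ⟪w r, w r⟫_ℂ).re := by
    have a1 : Continuous fun t => ⟪w t, w t⟫_ℂ := h.comp (continuous_id.prodMk continuous_id)
    have a2 : Continuous fun t => ⟪w t, w r⟫_ℂ := h.comp (continuous_id.prodMk continuous_const)
    have a3 : Continuous fun t => ⟪w r, w t⟫_ℂ := h.comp (continuous_const.prodMk continuous_id)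
    fun_prop
  simp_rw [h1]
  simpa using h2.tendsto r

/-- Vectors `vᵢ` with the same Gram matrix as the images of a total family `uᵢ` under a contraction
are the images of the `uᵢ` under a contraction. -/
theorem exists_contraction_of_gram [CompleteSpace F] {ι : Type*} {u : ι → E} {v : ι → F}
    (hu : (Submodule.span ℂ (Set.range u)).topologicalClosure = ⊤) {T : E →L[ℂ] E}
    (hT : ∀ x, ‖T x‖ ≤ ‖x‖) (h : ∀ i j, ⟪v i, v j⟫_ℂ = ⟪T (u i), T (u j)⟫_ℂ) :
    ∃ V : E →L[ℂ] F, (∀ i, V (u i) = v i) ∧ ∀ x, ‖V x‖ ≤ ‖x‖ := by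
  -- Defining the map on formal combinations avoids choosing representatives: the Gram identity
  -- gives `‖f c‖ = ‖T (e c)‖ ≤ ‖e c‖`, so `f` factors through `e` and extends by density.
  let e := Finsupp.linearCombination ℂ u
  let f := Finsupp.linearCombination ℂ v
  have hdense : DenseRange e := by
    have h1 : Dense (Submodule.span ℂ (Set.range u) : Set E) := by
      rw [Submodule.dense_iff_topologicalClosure_eq_top]
      exact hu
    rw [← Finsupp.range_linearCombination] at h1
    exact h1
  have hinner : ∀ c, ⟪f c, f c⟫_ℂ = ⟪T (e c), T (e c)⟫_ℂ := by
    intro c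
    simp only [f, e, Finsupp.linearCombination_apply, Finsupp.sum, map_sum, map_smul, sum_inner,
      inner_sum, inner_smul_left, inner_smul_right, h]
  have hnorm : ∀ c, ‖f c‖ ≤ 1 * ‖e c‖ := by
    intro c
    rw [one_mul]
    refine le_trans (le_of_eq ?_) (hT (e c))
    rw [norm_eq_sqrt_re_inner (𝕜 := ℂ), hinner, ← norm_eq_sqrt_re_inner]
  refine ⟨f.extendOfNorm e, fun i => ?_, fun x => ?_⟩
  · have h1 := LinearMap.extendOfNorm_eq hdense ⟨1, hnorm⟩ (Finsupp.single i 1)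
    simpa [e, f] using h1
  · simpa using LinearMap.norm_extendOfNorm_apply_le hdense 1 hnorm x

theorem IsNuclear.re_trace_comp_mono [CompleteSpace E] {T : E →L[ℂ] E} (hT : IsNuclear T)
    (h0 : 0 ≤ T) {x y : E →L[ℂ] E} (hxy : x ≤ y) :
    (trace (T ∘L x)).re ≤ (trace (T ∘L y)).re := by
  have h1 := hT.re_trace_comp_nonneg h0 (sub_nonneg.2 hxy)
  obtain ⟨u, v, h⟩ := hT
  have h2 : trace (T ∘L (y - x)) = trace (T ∘L y) - trace (T ∘L x) := by
    simp only [h.isRankOneSum.trace_comp]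
    rw [← (h.isRankOneSum.summable_inner y).tsum_sub (h.isRankOneSum.summable_inner x)]
    exact tsum_congr fun i => by rw [sub_apply, inner_sub_right]
  rw [h2, Complex.sub_re] at h1
  linarith

theorem integrable_smul_ketBra {X : Type*} [TopologicalSpace X] [MeasurableSpace X]
    [OpensMeasurableSpace X] [SecondCountableTopology X] {μ : Measure X} {c : X → ℂ}
    (hc : Integrable c μ) {a b : X → E} (ha : Continuous a) (hb : Continuous b) {A B : ℝ}
    (hA : ∀ x, ‖a x‖ ≤ A) (hB : ∀ x, ‖b x‖ ≤ B) :
    Integrable (fun x => c x • ketBra (a x) (b x)) μ := by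
  have h : Continuous fun x => ketBra (a x) (b x) :=
    ((ContinuousLinearMap.smulRightL ℂ E E).continuous.comp
      ((innerSL ℂ).continuous.comp hb)).clm_apply ha
  refine hc.smul_bdd (A * B) h.aestronglyMeasurable (Filter.Eventually.of_forall fun x => ?_)
  rw [InnerProductSpace.norm_rankOne]
  exact mul_le_mul (hA x) (hB x) (norm_nonneg _) ((norm_nonneg _).trans (hA x))

theorem inner_sum_smul_integral_apply [CompleteSpace E] {X : Type*} [MeasurableSpace X]
    {μ : Measure X} {ι κ : Type*} [Fintype ι] [Fintype κ] {F : ι → κ → X → E →L[ℂ] E}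
    (hF : ∀ i j, Integrable (F i j) μ) (c : ι → κ → ℂ) (y z : E) :
    ⟪y, (∑ i, ∑ j, c i j • ∫ x, F i j x ∂μ) z⟫_ℂ = ∫ x, ⟪y, (∑ i, ∑ j, c i j • F i j x) z⟫_ℂ ∂μ := by
  have hint : ∀ i j, Integrable (fun x => c i j • F i j x) μ := fun i j => (hF i j).smul (c i j)
  have hsum : ∑ i, ∑ j, c i j • ∫ x, F i j x ∂μ = ∫ x, ∑ i, ∑ j, c i j • F i j x ∂μ := by
    rw [integral_finsetSum _ fun i _ => integrable_finsetSum _ fun j _ => hint i j]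
    refine Finset.sum_congr rfl fun i _ => ?_
    rw [integral_finsetSum _ fun j _ => hint i j]
    exact Finset.sum_congr rfl fun j _ => (integral_smul _ _).symm
  rw [hsum]
  exact (((innerSL ℂ y) ∘L (ContinuousLinearMap.apply ℂ E z)).integral_comp_comm
    (integrable_finsetSum _ fun i _ => integrable_finsetSum _ fun j _ => hint i j)).symm

end HilbertSpace

/-! ### Continuity and boundedness of `r ↦ Ŝ_r^* (f₁ ∧ … ∧ fₙ)` -/

theorem wedge_eq_vacuum (f : Fin 0 → OneParticle) : wedge f = vacuum := by
  rw [vacuum, Subsingleton.elim f]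

theorem continuous_wedge_shiftAdj {n : ℕ} (f : Fin n → OneParticle) :
    Continuous fun r : ℝ≥0 => wedge fun i => shiftAdj r (f i) := by
  refine continuous_of_continuous_inner ?_
  simp only [inner_wedge_wedge]
  refine Continuous.matrix_det (continuous_matrix fun i j => ?_)
  exact ((continuous_shiftAdj (f i)).comp continuous_fst).inner
    ((continuous_shiftAdj (f j)).comp continuous_snd)

theorem norm_fockShift (r : ℝ≥0) (F : Fock) : ‖fockShift r F‖ = ‖F‖ :=
  (lpMap (shiftN r)).norm_map F

theorem norm_wedge_shiftAdj_le {n : ℕ} (f : Fin n → OneParticle) (r : ℝ≥0) :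
    ‖wedge fun i => shiftAdj r (f i)‖ ≤ ‖wedge f‖ := by
  have h1 : (wedge fun i => shiftAdj r (f i)) = adjoint (fockShift r) (wedge f) :=
    (adjoint_fockShift_wedge r f).symm
  rw [h1]
  refine (le_opNorm _ _).trans (mul_le_of_le_one_left (norm_nonneg _) ?_)
  rw [LinearIsometryEquiv.norm_map]
  exact opNorm_le_bound _ zero_le_one fun F => by rw [norm_fockShift, one_mul]

/-! ### The integrand -/

theorem preShiftSemigroup_ketBra (r : ℝ≥0) (a b : Fock) :
    preShiftSemigroup r (ketBra a b) =
      ketBra (adjoint (fockShift r) a) (adjoint (fockShift r) b) := by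
  rw [preShiftSemigroup, InnerProductSpace.rankOne_comp, InnerProductSpace.comp_rankOne]

theorem integrand_eq {m n : ℕ} (f : Fin (m + 1) → OneParticle) (g : Fin (n + 1) → OneParticle)
    (j : Fin (m + 1)) (k : Fin (n + 1)) (r : ℝ≥0) :
    integrand f g j k r = (f j r * conj (g k r)) •
      ketBra (wedge fun i => shiftAdj r (f (j.succAbove i)))
        (wedge fun i => shiftAdj r (g (k.succAbove i))) := by
  rw [integrand, preShiftSemigroup_ketBra, adjoint_fockShift_wedge, adjoint_fockShift_wedge]
  rfl

theorem integrable_integrand {m n : ℕ} (f : Fin (m + 1) → OneParticle)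
    (g : Fin (n + 1) → OneParticle) (j : Fin (m + 1)) (k : Fin (n + 1)) :
    Integrable (integrand f g j k) lebesgue := by
  have h1 : Integrable (fun r => f j r * conj (g k r)) lebesgue := by
    simpa only [mul_comm] using integrable_conj_mul (g k) (f j)
  refine Integrable.congr (integrable_smul_ketBra h1
    (continuous_wedge_shiftAdj fun i => f (j.succAbove i))
    (continuous_wedge_shiftAdj fun i => g (k.succAbove i))
    (norm_wedge_shiftAdj_le _) (norm_wedge_shiftAdj_le _))
    (Filter.Eventually.of_forall fun r => (integrand_eq f g j k r).symm)

/-! ### Annihilation of the first particle -/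

/-- The vector `∑_j (-1)^j f_j(r) Ŝ_r^* (f_{∖j})`. -/
def annihilate {n : ℕ} (f : Fin (n + 1) → OneParticle) (r : ℝ≥0) : Fock :=
  ∑ j : Fin (n + 1), ((-1 : ℂ) ^ (j : ℕ) * f j r) • wedge fun i => shiftAdj r (f (j.succAbove i))

/-- The sign `(-1)^{j+k}` and the scalar `f_j(r) conj(g_k(r))` split into a ket factor and a bra
factor. This factorisation is what makes the preadjoint formula positive. -/
theorem ketBra_annihilate {m n : ℕ} (f : Fin (m + 1) → OneParticle) (g : Fin (n + 1) → OneParticle)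
    (r : ℝ≥0) : ketBra (annihilate f r) (annihilate g r) =
      ∑ j : Fin (m + 1), ∑ k : Fin (n + 1), (-1 : ℂ) ^ ((j : ℕ) + (k : ℕ)) • integrand f g j k r := by
  refine ContinuousLinearMap.ext fun z => ?_
  simp only [annihilate, integrand_eq, InnerProductSpace.rankOne_apply, sum_inner, inner_smul_left,
    sum_apply, smul_apply, map_mul, map_pow, map_neg, map_one]
  rw [Finset.smul_sum]
  refine Finset.sum_congr rfl fun j _ => ?_
  rw [Finset.sum_smul]
  refine Finset.sum_congr rfl fun k _ => ?_
  rw [smul_smul, smul_smul, smul_smul]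
  congr 1
  ring

theorem memLp_annihilate {n : ℕ} (f : Fin (n + 1) → OneParticle) :
    MemLp (annihilate f) 2 lebesgue := by
  have h : annihilate f = fun r => ∑ j : Fin (n + 1), ((-1 : ℂ) ^ (j : ℕ) * f j r) •
      wedge fun i => shiftAdj r (f (j.succAbove i)) := rfl
  rw [h]
  refine memLp_finsetSum _ fun j _ => ?_
  refine ((Lp.memLp (f j)).const_mul ((-1 : ℂ) ^ (j : ℕ))).of_le_mul
    (c := ‖wedge fun i => f (j.succAbove i)‖) ?_ (Filter.Eventually.of_forall fun r => ?_)
  · exact (((Lp.memLp (f j)).const_mul ((-1 : ℂ) ^ (j : ℕ))).1).smul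
      (continuous_wedge_shiftAdj _).aestronglyMeasurable
  · rw [norm_smul, mul_comm]
    exact mul_le_mul_of_nonneg_right (norm_wedge_shiftAdj_le _ _) (norm_nonneg _)

/-- Puts the inner product into the shape of the integrand of `integral_det_tail`. -/
theorem inner_annihilate {n : ℕ} (f g : Fin (n + 1) → OneParticle) (r : ℝ≥0) :
    ⟪annihilate f r, annihilate g r⟫_ℂ =
      ∑ j : Fin (n + 1), ∑ k : Fin (n + 1), (-1) ^ ((j : ℕ) + (k : ℕ)) *
        ((conj (f j r) * g k r) * (Matrix.of fun a b => tail
          (fun x => conj (f (j.succAbove a) x) * g (k.succAbove b) x) r).det) := by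
  rw [annihilate, annihilate, sum_inner]
  refine Finset.sum_congr rfl fun j _ => ?_
  rw [inner_sum]
  refine Finset.sum_congr rfl fun k _ => ?_
  simp only [inner_smul_left, inner_smul_right, inner_wedge_wedge, inner_shiftAdj, map_mul,
    map_pow, map_neg, map_one, tail]
  ring

theorem inner_annihilate_of_ne {m n : ℕ} (h : m ≠ n) (f : Fin (m + 1) → OneParticle)
    (g : Fin (n + 1) → OneParticle) (r : ℝ≥0) : ⟪annihilate f r, annihilate g r⟫_ℂ = 0 := by
  simp only [annihilate, sum_inner, inner_sum, inner_smul_left, inner_smul_right,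
    inner_wedge_wedge_of_ne h, mul_zero, Finset.sum_const_zero]

/-- The germ of covariance: the scalar factors and, by the semigroup law, the wedge factors are both
translated by `s`. Only the former restrict the identity to almost every `r`. -/
theorem annihilate_shiftAdj {n : ℕ} (f : Fin (n + 1) → OneParticle) (s : ℝ≥0) :
    ∀ᵐ r ∂lebesgue, annihilate (fun i => shiftAdj s (f i)) r = annihilate f (r + s) := by
  have h : ∀ᵐ r ∂lebesgue, ∀ j, shiftAdj s (f j) r = f j (r + s) :=
    ae_all_iff.2 fun j => coeFn_shiftAdj s (f j)
  filter_upwards [h] with r hr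
  simp only [annihilate, hr, shiftAdj_shiftAdj]

/-- The vectors `annihilate f`, extended by zero to the vacuum. -/
def annihilateFamily : (Σ n : ℕ, Fin n → OneParticle) → ℝ≥0 → Fock
  | ⟨0, _⟩ => 0
  | ⟨_ + 1, f⟩ => annihilate f

theorem memLp_annihilateFamily (f : Σ n : ℕ, Fin n → OneParticle) :
    MemLp (annihilateFamily f) 2 lebesgue := by
  obtain ⟨_ | n, f⟩ := f
  · exact MemLp.zero
  · exact memLp_annihilate f

theorem annihilateFamily_shiftAdj (f : Σ n : ℕ, Fin n → OneParticle) (s : ℝ≥0) :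
    ∀ᵐ r ∂lebesgue, annihilateFamily ⟨f.1, fun i => shiftAdj s (f.2 i)⟩ r =
      annihilateFamily f (r + s) := by
  obtain ⟨_ | n, f⟩ := f
  · exact Filter.Eventually.of_forall fun r => rfl
  · exact annihilate_shiftAdj f s

theorem inner_toLp_annihilateFamily (f g : Σ n : ℕ, Fin n → OneParticle) :
    ⟪(memLp_annihilateFamily f).toLp _, (memLp_annihilateFamily g).toLp _⟫_ℂ =
      ∫ r, ⟪annihilateFamily f r, annihilateFamily g r⟫_ℂ ∂lebesgue := by
  rw [L2.inner_def]
  refine integral_congr_ae ?_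
  filter_upwards [(memLp_annihilateFamily f).coeFn_toLp, (memLp_annihilateFamily g).coeFn_toLp]
    with r h1 h2
  rw [h1, h2]

theorem integral_inner_annihilate {n : ℕ} (f g : Fin (n + 1) → OneParticle) :
    ∫ r, ⟪annihilate f r, annihilate g r⟫_ℂ ∂lebesgue = ⟪wedge f, wedge g⟫_ℂ := by
  simp only [inner_annihilate, inner_wedge_wedge, lebesgue_inner_eq_integral]
  exact integral_det_tail fun i j => integrable_conj_mul (f i) (g j)

/-- There is a contraction `V : F(H) → L²(ℝ₊; F(H))` with `(V f)(r) = ∑_j (-1)^j f_j(r) Ŝ_r^* f_{∖j}`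
for `f = f₁ ∧ … ∧ fₙ`. -/
theorem exists_annihilation : ∃ V : Fock →L[ℂ] Lp Fock 2 lebesgue,
    (∀ f, V (wedgeFamily f) = (memLp_annihilateFamily f).toLp _) ∧ ∀ x, ‖V x‖ ≤ ‖x‖ := by
  -- The comparison contraction: it kills the vacuum, as the family does, and fixes all wedges of
  -- positive degree, where the Gram matrices agree.
  let T : Fock →L[ℂ] Fock := (ℂ ∙ vacuum)ᗮ.starProjection
  have hT0 : ∀ f : Fin 0 → OneParticle, T (wedge f) = 0 := fun f => by
    rw [wedge_eq_vacuum]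
    exact Submodule.starProjection_orthogonal_apply_eq_zero (Submodule.mem_span_singleton_self _)
  have hT1 : ∀ (n : ℕ) (f : Fin (n + 1) → OneParticle), T (wedge f) = wedge f := fun n f => by
    refine Submodule.starProjection_eq_self_iff.2 ?_
    rw [Submodule.mem_orthogonal_singleton_iff_inner_right]
    exact inner_wedge_wedge_of_ne (Nat.succ_ne_zero n).symm _ _
  refine exists_contraction_of_gram topologicalClosure_span_wedge (T := T)
    (fun x => Submodule.norm_starProjection_apply_le _ x) ?_
  rintro ⟨_ | m, f⟩ ⟨_ | n, g⟩
  all_goals rw [inner_toLp_annihilateFamily]; simp only [wedgeFamily, annihilateFamily]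
  · simp [hT0]
  · simp [hT0]
  · simp [hT0]
  · rw [hT1, hT1]
    by_cases h : m = n
    · subst h
      exact integral_inner_annihilate f g
    · rw [inner_wedge_wedge_of_ne fun h' => h (Nat.succ_injective h')]
      simp only [inner_annihilate_of_ne h, integral_zero]

/-! ### The measure -/

/-- The contraction `V : F(H) → L²(ℝ₊; F(H))` with
`(V f)(r) = ∑_j (-1)^j f_j(r) Ŝ_r^* f_{∖j}` for `f = f₁ ∧ … ∧ fₙ`. -/
def annihilation : Fock →L[ℂ] Lp Fock 2 lebesgue := exists_annihilation.choose

theorem coeFn_annihilation (f : Σ n : ℕ, Fin n → OneParticle) :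
    annihilation (wedgeFamily f) =ᵐ[lebesgue] annihilateFamily f := by
  rw [annihilation, exists_annihilation.choose_spec.1 f]
  exact (memLp_annihilateFamily f).coeFn_toLp

theorem norm_annihilation_le (F : Fock) : ‖annihilation F‖ ≤ ‖F‖ :=
  exists_annihilation.choose_spec.2 F

/-- The completely positive map `𝓜(B)`. -/
def covariantMeasure (B : Set ℝ≥0) : (Fock →L[ℂ] Fock) →CP (Fock →L[ℂ] Fock) :=
  ampliationCP (restrictOp annihilation B)

/-- The preadjoint map `𝓜_*(B)`. -/
def preMeasure (B : Set ℝ≥0) : nuclear Fock →ₗ[ℂ] nuclear Fock :=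
  (isKrausFamily_component (norm_restrictOp_le norm_annihilation_le B)).map

theorem inner_covariantMeasure (B : Set ℝ≥0) (x : Fock →L[ℂ] Fock)
    (f g : Σ n : ℕ, Fin n → OneParticle) :
    ⟪wedgeFamily g, covariantMeasure B x (wedgeFamily f)⟫_ℂ =
      ∫ r in B, ⟪annihilateFamily g r, x (annihilateFamily f r)⟫_ℂ ∂lebesgue := by
  rw [covariantMeasure, inner_ampliationCP_restrictOp]
  refine integral_congr_ae (ae_restrict_of_ae ?_)
  filter_upwards [coeFn_annihilation f, coeFn_annihilation g] with r h1 h2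
  rw [h1, h2]

theorem trace_preMeasure_comp (B : Set ℝ≥0) (ρ : nuclear Fock) (x : Fock →L[ℂ] Fock) :
    trace ((preMeasure B ρ : Fock →L[ℂ] Fock) ∘L x) =
      trace ((ρ : Fock →L[ℂ] Fock) ∘L covariantMeasure B x) :=
  (isKrausFamily_component (norm_restrictOp_le norm_annihilation_le B)).trace_map_comp
    (M := fun x => covariantMeasure B x)
    (fun x u v => hasSum_inner_component (restrictOp annihilation B) x u v) ρ x

/-- Testing the duality on `x = |z⟩⟨y|` computes the preadjoint without reference to the Kraus
operators, hence to the chosen Hilbert basis. -/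
theorem inner_preMeasure_ketBra (B : Set ℝ≥0) (f g : Σ n : ℕ, Fin n → OneParticle) (y z : Fock) :
    ⟪y, (preMeasure B (nuclearKetBra (wedgeFamily f) (wedgeFamily g)) : Fock →L[ℂ] Fock) z⟫_ℂ =
      ∫ r in B, ⟪y, ketBra (annihilateFamily f r) (annihilateFamily g r) z⟫_ℂ ∂lebesgue := by
  rw [← IsNuclear.trace_comp_ketBra (preMeasure B _).2, trace_preMeasure_comp, nuclearKetBra,
    trace_ketBra_comp, inner_covariantMeasure]
  refine integral_congr_ae (Filter.Eventually.of_forall fun r => ?_)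
  simp only [InnerProductSpace.rankOne_apply, inner_smul_right, mul_comm]

theorem preMeasure_eq_zero {B : Set ℝ≥0} {f g : Σ n : ℕ, Fin n → OneParticle}
    (h : ∀ r, ketBra (annihilateFamily f r) (annihilateFamily g r) = 0) :
    preMeasure B (nuclearKetBra (wedgeFamily f) (wedgeFamily g)) = 0 := by
  refine Subtype.ext (ContinuousLinearMap.ext fun z => ext_inner_left ℂ fun y => ?_)
  rw [inner_preMeasure_ketBra]
  simp [h]

theorem isPreadjointMap_preMeasure (B : Set ℝ≥0) : IsPreadjointMap B (preMeasure B) where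
  bounded := ⟨1, fun ρ => by
    rw [one_mul]
    exact (isKrausFamily_component
      (norm_restrictOp_le norm_annihilation_le B)).nuclearNorm_map_le ρ⟩
  map_wedge m n f g := by
    refine ContinuousLinearMap.ext fun z => ext_inner_left ℂ fun y => ?_
    refine (inner_preMeasure_ketBra B ⟨m + 1, f⟩ ⟨n + 1, g⟩ y z).trans ?_
    refine Eq.trans ?_ (inner_sum_smul_integral_apply
      (fun j k => (integrable_integrand f g j k).restrict (s := B))
      (fun j k => (-1 : ℂ) ^ ((j : ℕ) + (k : ℕ))) y z).symm
    simp only [annihilateFamily, ketBra_annihilate]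
  map_vacuum_left n g :=
    preMeasure_eq_zero (f := ⟨0, Fin.elim0⟩) (g := ⟨n, g⟩) fun r => by simp [annihilateFamily]
  map_vacuum_right n f :=
    preMeasure_eq_zero (f := ⟨n, f⟩) (g := ⟨0, Fin.elim0⟩) fun r => by simp [annihilateFamily]

theorem IsPreadjointMap.unique {B : Set ℝ≥0} {L L' : nuclear Fock →ₗ[ℂ] nuclear Fock}
    (h : IsPreadjointMap B L) (h' : IsPreadjointMap B L') : L = L' := by
  refine nuclear_linearMap_ext topologicalClosure_span_wedge h.bounded h'.bounded ?_
  rintro ⟨m, f⟩ ⟨n, g⟩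
  change L (nuclearKetBra (wedge f) (wedge g)) = L' (nuclearKetBra (wedge f) (wedge g))
  rcases m with _ | m
  · rw [wedge_eq_vacuum f, h.map_vacuum_left, h'.map_vacuum_left]
  rcases n with _ | n
  · rw [wedge_eq_vacuum g, h.map_vacuum_right, h'.map_vacuum_right]
  exact Subtype.ext ((h.map_wedge m n f g).trans (h'.map_wedge m n f g).symm)

theorem ext_wedge {x y : Fock →L[ℂ] Fock} (h : ∀ f g : Σ n : ℕ, Fin n → OneParticle,
    ⟪wedgeFamily g, x (wedgeFamily f)⟫_ℂ = ⟪wedgeFamily g, y (wedgeFamily f)⟫_ℂ) : x = y := by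
  have hdense : Dense (Submodule.span ℂ (Set.range wedgeFamily) : Set Fock) := by
    rw [Submodule.dense_iff_topologicalClosure_eq_top]
    exact topologicalClosure_span_wedge
  refine ContinuousLinearMap.ext_on hdense ?_
  rintro _ ⟨f, rfl⟩
  refine ext_inner_wedge fun n g => ?_
  rw [← inner_conj_symm, ← inner_conj_symm (y _)]
  exact congrArg _ (h f ⟨n, g⟩)

/-- Between wedge vectors, the outer shifts become left shifts of the `f_i` and `g_i`, that is, a
translation of `r` by `s` in the integrand, which the substitution `r ↦ r + s` turns into a
translation of `B`. -/
theorem shiftSemigroup_covariantMeasure (s : ℝ≥0) (B : Set ℝ≥0) (x : Fock →L[ℂ] Fock) :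
    shiftSemigroup s (covariantMeasure B x) = covariantMeasure ((fun t => t + s) '' B) x := by
  refine ext_wedge fun f g => ?_
  have h : ∀ f : Σ n : ℕ, Fin n → OneParticle, adjoint (fockShift s) (wedgeFamily f) =
      wedgeFamily ⟨f.1, fun i => shiftAdj s (f.2 i)⟩ := fun f => adjoint_fockShift_wedge s f.2
  rw [inner_covariantMeasure, ← setIntegral_add s
    (fun r => ⟪annihilateFamily g r, x (annihilateFamily f r)⟫_ℂ) B, shiftSemigroup,
    ContinuousLinearMap.comp_apply, ContinuousLinearMap.comp_apply, ← adjoint_inner_left, h, h,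
    inner_covariantMeasure]
  refine integral_congr_ae (ae_restrict_of_ae ?_)
  filter_upwards [annihilateFamily_shiftAdj f s, annihilateFamily_shiftAdj g s] with r h1 h2
  rw [h1, h2]

theorem isCovariantMeasure_covariantMeasure : IsCovariantMeasure shiftSemigroup covariantMeasure where
  subunital B _ := ampliationCP_one_le (norm_restrictOp_le norm_annihilation_le B)
  sigma_additive := exists_complexMeasure_trace_ampliationCP annihilation
  covariant s B _ x := shiftSemigroup_covariantMeasure s B x

theorem preMeasure_nonneg (B : Set ℝ≥0) {ρ : nuclear Fock} (h : 0 ≤ (ρ : Fock →L[ℂ] Fock)) :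
    0 ≤ (preMeasure B ρ : Fock →L[ℂ] Fock) :=
  (isKrausFamily_component (norm_restrictOp_le norm_annihilation_le B)).map_nonneg h

/-- Dual to subunitality: apply the duality at `x = 1` and use monotonicity of `x ↦ Tr(ρ x)`. -/
theorem re_trace_preMeasure_le (B : Set ℝ≥0) {ρ : nuclear Fock}
    (h : 0 ≤ (ρ : Fock →L[ℂ] Fock)) :
    (trace (preMeasure B ρ : Fock →L[ℂ] Fock)).re ≤ (trace (ρ : Fock →L[ℂ] Fock)).re := by
  have h1 := trace_preMeasure_comp B ρ 1
  have h2 := IsNuclear.re_trace_comp_mono ρ.2 h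
    (ampliationCP_one_le (norm_restrictOp_le norm_annihilation_le B))
  have h3 : ∀ T : Fock →L[ℂ] Fock, T ∘L (1 : Fock →L[ℂ] Fock) = T := fun T => T.comp_id
  rw [h3] at h1 h2
  rw [h1]
  exact h2

end ShiftCAR

end

open ShiftCAR in
theorem proposition3 :
    -- the integrals in the definition of the preadjoint map converge absolutely
    (∀ (m n : ℕ) (f : Fin (m + 1) → OneParticle) (g : Fin (n + 1) → OneParticle)
      (j : Fin (m + 1)) (k : Fin (n + 1)), Integrable (integrand f g j k) lebesgue) ∧
    ∃ (Mpre : Set ℝ≥0 → (nuclear Fock →ₗ[ℂ] nuclear Fock))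
      (M : Set ℝ≥0 → ((Fock →L[ℂ] Fock) →CP (Fock →L[ℂ] Fock))),
      -- the formula on rank-one operators determines a unique bounded map of the nuclear operators
      (∀ B, MeasurableSet B →
        IsPreadjointMap B (Mpre B) ∧ ∀ L, IsPreadjointMap B L → L = Mpre B) ∧
      -- which does not increase the trace of positive operators
      (∀ B, MeasurableSet B → ∀ ρ : nuclear Fock, 0 ≤ (ρ : Fock →L[ℂ] Fock) →
        0 ≤ (Mpre B ρ : Fock →L[ℂ] Fock) ∧
        (trace (Mpre B ρ : Fock →L[ℂ] Fock)).re ≤ (trace (ρ : Fock →L[ℂ] Fock)).re) ∧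
      -- `M B` is the adjoint of `Mpre B`
      (∀ B, MeasurableSet B →
        (∀ (ρ : nuclear Fock) (x : Fock →L[ℂ] Fock),
          trace ((Mpre B ρ : Fock →L[ℂ] Fock) ∘L x) = trace ((ρ : Fock →L[ℂ] Fock) ∘L M B x)) ∧
        ∀ N : (Fock →L[ℂ] Fock) → (Fock →L[ℂ] Fock),
          (∀ (ρ : nuclear Fock) (x : Fock →L[ℂ] Fock),
            trace ((Mpre B ρ : Fock →L[ℂ] Fock) ∘L x) = trace ((ρ : Fock →L[ℂ] Fock) ∘L N x)) →
          N = M B) ∧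
      -- and `M` is a measure covariant with respect to the shift semigroup
      IsCovariantMeasure shiftSemigroup M := by
  refine ⟨fun m n f g j k => integrable_integrand f g j k, preMeasure, covariantMeasure,
    fun B _ => ⟨isPreadjointMap_preMeasure B, fun L hL => hL.unique (isPreadjointMap_preMeasure B)⟩,
    fun B _ ρ hρ => ⟨preMeasure_nonneg B hρ, re_trace_preMeasure_le B hρ⟩,
    fun B _ => ⟨trace_preMeasure_comp B, fun N hN => ?_⟩, isCovariantMeasure_covariantMeasure⟩
  exact eq_of_trace_comp_eq fun ρ x => (hN ρ x).symm.trans (trace_preMeasure_comp B ρ x)
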